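/- Write $\pm[n]=\{-n,\dots,-1,1,\dots,n\}$. A $\Delta$-graph is a simplicial complex $\Delta$ together with a simple graph on its vertices all of whose edges are faces of $\Delta$. A tube is a nonempty face of $\Delta$ that induces a connected subgraph. A tubing is a set $T$ of tubes such that $\bigcup T$ is a face of $\Delta$ and any two tubes in $T$ are either nested, or disjoint with no edge between them. A graph associahedron of a $\Delta$-graph is a full-dimensional simple polyhedron in some $\mathbb R^n$ whose dual simplicial complex (the sets of facets with nonempty common intersection) is isomorphic to the complex of tubings. A hypercube graph is a $\Delta$-graph on $\pm[n]$ where $\Delta$ consists of the subsets of $\pm[n]$ containing no pair $\{i,-i\}$. For a family $G=(G_n)_{n\ge 0}$ in which $G_n$ has an $n$-dimensional graph associahedron $P_n$, let $f^G(x,y)=\sum_{n,k\ge0} f_k(G_n)\,x^ky^n$, where $f_k(G_n)$ is the number of tubings of $G_n$ with exactly $n-k$ tubes ($0\le k\le n$). Consider the following families. * $f^{TP}$: the twisted path hypercube graphs $TP_n$ on $\pm[n]$, consisting of the path $(1,\dots,n,-1,\dots,-n)$ (for $n=1$ the non-face $\{1,-1\}$ is not an edge). * $f^{A}$: the associahedra;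 $G_n$ is the path $(1,\dots,n+1)$, where $\Delta$ is the complex of proper subsets of $\{1,\dots,n+1\}$. * $f^{C}$: the cis double path graphs $C_n$, obtained from the hypercube graph on $\pm[n]$ consisting of the two paths $(1,\dots,n)$ and $(-1,\dots,-n)$ by deleting the vertices $-1$ and $-n$, together with all faces and edges containing them. Then the following hold. 1. For each of these three families, $f_k(G_n)$ is the number of $k$-dimensional faces of every $n$-dimensional graph associahedron of $G_n$. Thus $f^G$ is the bivariate $f$-polynomial of the family of graph associahedra. 2. As formal power series, with $D_y=\partial/\partial y$, $$f^{TP}(x,y)=\left(1+\frac{xy}{(1-xy)(1+yf^A)-2yf^A}+yf^A\,(f^C-1)\right)\Bigl(1+y\,\bigl(2f^A+y\,D_yf^A\bigr)\Bigr),$$ where the denominator is invertible. 3. The generating function of the number of vertices of the $n$-dimensional twisted path hypercube graph associahedron is $$f^{TP}(0,y)=\frac{1-2y+\sqrt{1-4y}}{2(1-4y)},$$ where $\sqrt{1-4y}$ is the formal power series with constant term $1$ whose square is $1-4y$. -/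

import Mathlib

open Polynomial PowerSeries

/-! ### Graphs on simplicial complexes, tubes and tubings -/

/-- A `Δ`-graph: a simplicial complex `Δ` (its faces, the empty face included) together with a simple
graph all of whose edges are faces of `Δ`. Elements of `V` that lie in no face play no role. -/
structure DeltaGraph (V : Type*) [DecidableEq V] where
  /-- the faces of `Δ` -/
  faces : Set (Finset V)
  empty_mem : ∅ ∈ faces
  down_closed : ∀ s ∈ faces, ∀ t, t ⊆ s → t ∈ faces
  /-- the graph -/
  graph : SimpleGraph V
  edge_mem : ∀ u v, graph.Adj u v → ({u, v} : Finset V) ∈ faces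

namespace DeltaGraph

variable {V : Type*} [DecidableEq V]

/-- A tube: a nonempty face of `Δ` that induces a connected subgraph. -/
def IsTube (G : DeltaGraph V) (t : Finset V) : Prop :=
  t ∈ G.faces ∧ (G.graph.induce (t : Set V)).Connected

/-- Weak compatibility: nested, or disjoint and with no edge between them. -/
def WeaklyCompatible (G : DeltaGraph V) (s t : Finset V) : Prop :=
  s ⊆ t ∨ t ⊆ s ∨ (Disjoint s t ∧ ∀ u ∈ s, ∀ v ∈ t, ¬ G.graph.Adj u v)

/-- A tubing: a finite set of pairwise weakly compatible tubes whose union is a face of `Δ`. -/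
def IsTubing (G : DeltaGraph V) (T : Finset (Finset V)) : Prop :=
  (∀ t ∈ T, G.IsTube t) ∧ (T : Set (Finset V)).Pairwise G.WeaklyCompatible ∧
    T.biUnion id ∈ G.faces

/-- The number of tubings of `G` that consist of exactly `m` tubes. -/
noncomputable def tubingCount (G : DeltaGraph V) (m : ℕ) : ℕ :=
  {T : Finset (Finset V) | G.IsTubing T ∧ T.card = m}.ncard

/-- The `Δ`-graph on the complex `Δ` whose edges are the pairs `{u, v}` of distinct elements with
`r u v` or `r v u` that are faces of `Δ`. -/
def ofRel (faces : Set (Finset V)) (h₀ : ∅ ∈ faces)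
    (h₁ : ∀ s ∈ faces, ∀ t, t ⊆ s → t ∈ faces) (r : V → V → Prop) : DeltaGraph V where
  faces := faces
  empty_mem := h₀
  down_closed := h₁
  graph :=
    { Adj := fun u v => u ≠ v ∧ (r u v ∨ r v u) ∧ ({u, v} : Finset V) ∈ faces
      symm := ⟨fun u v h => ⟨h.1.symm, h.2.1.symm, Finset.pair_comm u v ▸ h.2.2⟩⟩
      loopless := ⟨fun _ h => h.1 rfl⟩ }
  edge_mem := fun _ _ h => h.2.2

/-- Deleting a set `S` of vertices: all faces and edges that meet `S` are removed. -/
def delete (G : DeltaGraph V) (S : Finset V) : DeltaGraph V :=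
  ofRel {F | F ∈ G.faces ∧ Disjoint F S} ⟨G.empty_mem, Finset.disjoint_empty_left S⟩
    (fun s hs t hts => ⟨G.down_closed s hs.1 t hts, hs.2.mono_left hts⟩) G.graph.Adj

end DeltaGraph

/-! ### The families of graphs -/

/-- The dual complex of the `n`-cube: subsets of `±[n] = {-n, …, -1, 1, …, n}` that do not contain
both `i` and `-i` for any `i`. -/
def cubeFaces (n : ℕ) : Set (Finset ℤ) :=
  {F | ∀ v ∈ F, v ≠ 0 ∧ |v| ≤ (n : ℤ) ∧ -v ∉ F}

/-- The dual complex of the `n`-simplex: proper subsets of `[n + 1] = {1, …, n + 1}`. -/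
def simplexFaces (n : ℕ) : Set (Finset ℤ) :=
  {F | F ⊂ Finset.Icc (1 : ℤ) (n + 1)}

/-- A hypercube graph on `±[n]`. -/
def hypercubeGraph (n : ℕ) (r : ℤ → ℤ → Prop) : DeltaGraph ℤ :=
  DeltaGraph.ofRel (cubeFaces n) (by simp [cubeFaces])
    (fun _ hs _ hts v hv => ⟨(hs v (hts hv)).1, (hs v (hts hv)).2.1,
      fun h => (hs v (hts hv)).2.2 (hts h)⟩) r

/-- The twisted path graph on `±[n]`: the path `(1, …, n, -1, …, -n)`. (For `n = 1` the pair
`{1, -1}` is not a face, so that there is no edge.) -/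
def twistedPath (n : ℕ) : DeltaGraph ℤ :=
  hypercubeGraph n fun u v =>
    (1 ≤ u ∧ v = u + 1 ∧ v ≤ n) ∨ (u = n ∧ v = -1) ∨ (u ≤ -1 ∧ v = u - 1 ∧ -(n : ℤ) ≤ v)

/-- The double path graph on `±[n]`: the two paths `(1, …, n)` and `(-1, …, -n)`. -/
def doublePath (n : ℕ) : DeltaGraph ℤ :=
  hypercubeGraph n fun u v =>
    (1 ≤ u ∧ v = u + 1 ∧ v ≤ n) ∨ (u ≤ -1 ∧ v = u - 1 ∧ -(n : ℤ) ≤ v)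

/-- The cis double path graph: the double path graph without the vertices `-1` and `-n`. -/
def cisDoublePath (n : ℕ) : DeltaGraph ℤ :=
  (doublePath n).delete {-1, -(n : ℤ)}

/-- The path `(1, …, n + 1)` on the dual complex of the `n`-simplex; its associahedron is the
`n`-dimensional associahedron. -/
def simplexPath (n : ℕ) : DeltaGraph ℤ :=
  DeltaGraph.ofRel (simplexFaces n)
    (Finset.empty_ssubset.2 ⟨1, Finset.mem_Icc.2 ⟨le_rfl, by omega⟩⟩)
    (fun _ hs _ hts => lt_of_le_of_lt hts hs) fun u v => v = u + 1

/-! ### Simple polyhedra and graph associahedra -/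

section Polyhedra

variable {n : ℕ}

/-- A polyhedron: the solution set of finitely many non-strict linear inequalities. -/
def IsPolyhedron (P : Set (EuclideanSpace ℝ (Fin n))) : Prop :=
  ∃ H : Finset (StrongDual ℝ (EuclideanSpace ℝ (Fin n)) × ℝ), P = {x | ∀ h ∈ H, h.2 ≤ h.1 x}

/-- The dimension of (the affine span of) a nonempty set. -/
noncomputable def affDim (F : Set (EuclideanSpace ℝ (Fin n))) : ℕ :=
  Module.finrank ℝ (vectorSpan ℝ F)

/-- The nonempty faces of `P` (`P` itself included). -/
def IsFace (P F : Set (EuclideanSpace ℝ (Fin n))) : Prop :=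
  F.Nonempty ∧ IsExposed ℝ P F

/-- The facets of a full-dimensional polyhedron in `ℝⁿ`. -/
def IsFacet (P F : Set (EuclideanSpace ℝ (Fin n))) : Prop :=
  IsFace P F ∧ affDim F + 1 = n

/-- A full-dimensional simple polyhedron in `ℝⁿ`: each face of codimension `k` lies in exactly `k`
facets. -/
def IsSimplePolyhedron (P : Set (EuclideanSpace ℝ (Fin n))) : Prop :=
  IsPolyhedron P ∧ P.Nonempty ∧ affDim P = n ∧
    ∀ F, IsFace P F → {Q | IsFacet P Q ∧ F ⊆ Q}.ncard + affDim F = n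

/-- `P` is a graph associahedron of `G`: a simple polyhedron whose dual simplicial complex (the sets
of facets with a common point) is isomorphic to the complex of tubings of `G`. -/
def IsGraphAssociahedron {V : Type*} [DecidableEq V] (G : DeltaGraph V)
    (P : Set (EuclideanSpace ℝ (Fin n))) : Prop :=
  IsSimplePolyhedron P ∧
    ∃ e : {t // G.IsTube t} ≃ {F // IsFacet P F}, ∀ T : Finset {t // G.IsTube t},
      G.IsTubing (T.map (Function.Embedding.subtype _)) ↔
        (P ∩ ⋂ t ∈ T, (e t : Set (EuclideanSpace ℝ (Fin n)))).Nonempty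

/-- The `f`-polynomial of a polyhedron in `ℝⁿ`: the coefficient of `x ^ k` is the number of
`k`-dimensional faces. -/
noncomputable def facePolynomial (P : Set (EuclideanSpace ℝ (Fin n))) : ℚ[X] :=
  ∑ k ∈ Finset.range (n + 1), Polynomial.monomial k ({F | IsFace P F ∧ affDim F = k}.ncard : ℚ)

end Polyhedra

/-! ### Bivariate `f`-polynomials, as power series in `y` over the polynomials in `x` -/

/-- The bivariate `f`-polynomial of the family of associahedra of `G 0, G 1, …` (where `G n` has an
`n`-dimensional associahedron): a `k`-dimensional face of the associahedron of `G n` is dual to a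
tubing with `n - k` tubes, so the coefficient of `x ^ k y ^ n` is the number of these tubings. -/
noncomputable def bivariateF {V : Type*} [DecidableEq V] (G : ℕ → DeltaGraph V) : ℚ[X]⟦X⟧ :=
  PowerSeries.mk fun n =>
    ∑ k ∈ Finset.range (n + 1), Polynomial.monomial k ((G n).tubingCount (n - k) : ℚ)

/-! In a simple polyhedron a face is determined by the facets through it, and its codimension is
their number. So the k-dimensional faces of a graph associahedron correspond to the tubings with n -
k tubes (`IsGraphAssociahedron.ncard_faces`). The rest is a count of tubings.

Tubings are sorted by their union σ. Those with union σ depend only on the graph induced on σ, and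
their generating polynomial is multiplicative over separated pieces (`coverPoly_union`). Every face
of the three complexes induces a subgraph that embeds as a set of positions on the infinite path, so
its weight is a product of polynomials b_j (`pathPoly j`), one for each maximal run of j positions.
With A = f^A, removing the tube that is the whole path gives B = Σ b_j y^j = 1 + yA.

A face of the cube complex is a word in three letters: i, -i, or neither, the last with weight x.
Removing the last letter gives a linear recursion with two states, according to the letter of the
run at the end. It is solved once, in `transfer_recursion`, for an arbitrary weight φ of the second
letter. Let β_j be the weight of an initial run of j second letters, and let P and Q be the series
of the words that do not end in the first, respectively the second, letter. Then P·D·B = Σ β_j y^j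
and Q = (1 - D)P, where D = 2 - B - xyB is the denominator in the formula.

For the cis double path no initial run of second letters is allowed, so Σ β_j y^j = 1; since the
last letter may not be the second one, f^C - 1 = Q, whence (f^C - 1)·D·B = 1 - D. For the twisted
path, the final run of first letters, of length k, joins the initial run of second letters, so β_j =
b_{k+j}. Summing over k gives f^TP·D·B = Σ (n + 1) b_n y^n = (yB)' = 1 + y(2A + yA'). The stated
formula follows because 1 + xy/D + yA(f^C - 1) is the inverse of D·B.

At x = 0, B becomes the Catalan series β = 1 + yβ², and f^TP(0, y) = 1/(2 - β)². The square root of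
1 - 4y is (2 - β)/β. -/

/-! ### Faces of simple polyhedra and tubings. -/

section PolyhedronFaces

variable {n : ℕ}

/-- The solution set of a finite system of linear inequalities. -/
def inequalitySet (H : Finset (StrongDual ℝ (EuclideanSpace ℝ (Fin n)) × ℝ)) :
    Set (EuclideanSpace ℝ (Fin n)) :=
  {x | ∀ h ∈ H, h.2 ≤ h.1 x}

/-- The part of `P` on which the inequality `h` is tight. -/
def tightSet (P : Set (EuclideanSpace ℝ (Fin n)))
    (h : StrongDual ℝ (EuclideanSpace ℝ (Fin n)) × ℝ) : Set (EuclideanSpace ℝ (Fin n)) :=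
  {x ∈ P | h.1 x = h.2}

/-- A system of inequalities in which every inequality can be made tight on its own. -/
def IsIrredundant (H : Finset (StrongDual ℝ (EuclideanSpace ℝ (Fin n)) × ℝ)) : Prop :=
  ∀ h ∈ H, h.1 ≠ 0 ∧ ∃ y, h.1 y = h.2 ∧ ∀ h' ∈ H, h' ≠ h → h'.2 < h'.1 y

theorem convex_inequalitySet (H : Finset (StrongDual ℝ (EuclideanSpace ℝ (Fin n)) × ℝ)) :
    Convex ℝ (inequalitySet H) := by
  intro x hx y hy a b ha hb hab h hh
  have h1 := mul_le_mul_of_nonneg_left (hx h hh) ha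
  have h2 := mul_le_mul_of_nonneg_left (hy h hh) hb
  have h3 : h.2 = a * h.2 + b * h.2 := by rw [← add_mul, hab, one_mul]
  simp only [map_add, map_smul, smul_eq_mul]
  linarith

theorem eventually_add_smul_mem (H : Finset (StrongDual ℝ (EuclideanSpace ℝ (Fin n)) × ℝ))
    {p v : EuclideanSpace ℝ (Fin n)} (hp : p ∈ inequalitySet H)
    (hv : ∀ h ∈ H, h.1 p = h.2 → 0 ≤ h.1 v) :
    ∃ ε : ℝ, 0 < ε ∧ p + ε • v ∈ inequalitySet H := by
  have key : ∀ᶠ ε : ℝ in nhdsWithin 0 (Set.Ioi 0), ∀ h ∈ H, h.2 ≤ h.1 (p + ε • v) := by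
    rw [Filter.eventually_all_finset]
    intro h hh
    rcases (hp h hh).eq_or_lt with heq | hlt
    · filter_upwards [self_mem_nhdsWithin] with ε hε
      have := mul_nonneg (le_of_lt hε) (hv h hh heq.symm)
      simp only [map_add, map_smul, smul_eq_mul]
      linarith
    · have hc : Continuous fun ε : ℝ => h.1 (p + ε • v) := by fun_prop
      have : ∀ᶠ ε : ℝ in nhds 0, h.2 < h.1 (p + ε • v) :=
        hc.continuousAt.eventually_const_lt (by simpa using hlt)
      exact (this.filter_mono nhdsWithin_le_nhds).mono fun _ => le_of_lt
  obtain ⟨ε, h1, h2⟩ := (key.and self_mem_nhdsWithin).exists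
  exact ⟨ε, h2, h1⟩

theorem exists_interior_point {P : Set (EuclideanSpace ℝ (Fin n))} (hP : P.Nonempty)
    (hc : Convex ℝ P) (hdim : affDim P = n) : (interior P).Nonempty := by
  rw [hc.interior_nonempty_iff_affineSpan_eq_top,
    AffineSubspace.affineSpan_eq_top_iff_vectorSpan_eq_top_of_nonempty ℝ _ _ hP]
  apply Submodule.eq_top_of_finrank_eq
  simpa [affDim] using hdim

theorem lt_of_mem_interior {P : Set (EuclideanSpace ℝ (Fin n))} {z : EuclideanSpace ℝ (Fin n)}
    (hz : z ∈ interior P) {l : StrongDual ℝ (EuclideanSpace ℝ (Fin n))} (hl : l ≠ 0) {c : ℝ}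
    (h : ∀ x ∈ P, c ≤ l x) : c < l z := by
  obtain ⟨w, hw⟩ : ∃ w, l w ≠ 0 := by
    by_contra! hcon
    exact hl (ContinuousLinearMap.ext hcon)
  -- Scaling `w` by `l w` fixes the sign: along this ray `l` drops by `ε * (l w)^2 > 0`, below a
  -- value that is already at least `c`.
  have hcont : Continuous fun ε : ℝ => z - ε • (l w • w) := by fun_prop
  have : ∀ᶠ ε : ℝ in nhds 0, z - ε • (l w • w) ∈ P :=
    hcont.continuousAt.eventually (by simpa using mem_interior_iff_mem_nhds.1 hz)
  obtain ⟨ε, h1, h2⟩ := ((this.filter_mono nhdsWithin_le_nhds).and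
    (self_mem_nhdsWithin (s := Set.Ioi (0 : ℝ)))).exists
  have h3 := h _ h1
  have h4 : 0 < ε * (l w * l w) := mul_pos h2 (mul_self_pos.2 hw)
  simp only [map_sub, map_smul, smul_eq_mul] at h3
  linarith

/-- A system with the fewest inequalities works. Each `h` is then violated by some point `x` that
satisfies all the others, and the segment from an interior point `z` to `x` crosses the hyperplane
of `h` where the others are strict. -/
theorem exists_irredundant {P : Set (EuclideanSpace ℝ (Fin n))} (hP : IsPolyhedron P)
    (hne : P.Nonempty) (hdim : affDim P = n) :
    ∃ H, P = inequalitySet H ∧ IsIrredundant H := by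
  classical
  obtain ⟨H, hH, hmin⟩ := WellFounded.has_min
    (measure (Finset.card (α := StrongDual ℝ (EuclideanSpace ℝ (Fin n)) × ℝ))).wf
    {H | P = inequalitySet H} hP
  refine ⟨H, hH, fun h hh => ?_⟩
  have hH' : P = inequalitySet H := hH
  obtain ⟨z, hz⟩ := exists_interior_point hne (hH' ▸ convex_inequalitySet H) hdim
  have hsub : ¬ inequalitySet (H.erase h) ⊆ inequalitySet H := by
    intro hsub
    refine hmin (H.erase h) ?_ (Finset.card_erase_lt_of_mem hh)
    refine hH'.trans (subset_antisymm ?_ hsub)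
    exact fun x hx h' hh' => hx h' (Finset.mem_of_mem_erase hh')
  obtain ⟨x, hx, hx'⟩ := Set.not_subset.1 hsub
  have hxh : h.1 x < h.2 := by
    by_contra! hcon
    refine hx' fun h' hh' => ?_
    by_cases e : h' = h
    · exact e ▸ hcon
    · exact hx h' (Finset.mem_erase.2 ⟨e, hh'⟩)
  have hzP : z ∈ inequalitySet H := hH' ▸ interior_subset hz
  have hstrict : ∀ h' ∈ H, h'.1 ≠ 0 → h'.2 < h'.1 z := fun h' hh' h0 =>
    lt_of_mem_interior hz h0 fun y hy => (hH' ▸ hy : y ∈ inequalitySet H) h' hh'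
  have h0 : h.1 ≠ 0 := by
    intro h0
    have := hzP h hh
    simp only [h0, zero_apply] at this hxh
    linarith
  refine ⟨h0, ?_⟩
  have hzh := hstrict h hh h0
  -- The parameter at which the segment from `z` to `x` meets the hyperplane of `h`.
  set t : ℝ := (h.1 z - h.2) / (h.1 z - h.1 x) with ht
  have hpos : 0 < h.1 z - h.1 x := by linarith
  have ht0 : 0 < t := div_pos (by linarith) hpos
  have ht1 : t < 1 := (div_lt_one hpos).2 (by linarith)
  have htm : t * (h.1 z - h.1 x) = h.1 z - h.2 := div_mul_cancel₀ _ hpos.ne'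
  refine ⟨z + t • (x - z), ?_, fun h' hh' hne' => ?_⟩
  · simp only [map_add, map_smul, map_sub, smul_eq_mul]
    linarith
  · have h1 := hx h' (Finset.mem_erase.2 ⟨hne', hh'⟩)
    have h2 := hzP h' hh'
    simp only [map_add, map_smul, map_sub, smul_eq_mul]
    -- An inequality with zero functional need not be strict at `z`. As it holds at `z`, it holds
    -- everywhere and could be dropped, against minimality.
    by_cases h00 : h'.1 = 0
    · exfalso
      refine hmin (H.erase h') ?_ (Finset.card_erase_lt_of_mem hh')
      refine hH'.trans (subset_antisymm
        (fun y hy g hg => hy g (Finset.mem_of_mem_erase hg)) fun y hy g hg => ?_)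
      by_cases e : g = h'
      · subst e
        simpa [h00] using h2
      · exact hy g (Finset.mem_erase.2 ⟨e, hg⟩)
    · have h3 := hstrict h' hh' h00
      have := mul_pos (sub_pos.2 ht1) (sub_pos.2 h3)
      have := mul_nonneg ht0.le (sub_nonneg.2 h1)
      nlinarith

theorem vectorSpan_le_ker {F : Set (EuclideanSpace ℝ (Fin n))}
    {l : StrongDual ℝ (EuclideanSpace ℝ (Fin n))} {c : ℝ} (h : ∀ x ∈ F, l x = c) :
    vectorSpan ℝ F ≤ LinearMap.ker (l : EuclideanSpace ℝ (Fin n) →ₗ[ℝ] ℝ) := by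
  rw [vectorSpan_def, Submodule.span_le]
  rintro _ ⟨x, hx, y, hy, rfl⟩
  simp [h x hx, h y hy]

theorem mem_vectorSpan_of_add_smul_mem {F : Set (EuclideanSpace ℝ (Fin n))}
    {p v : EuclideanSpace ℝ (Fin n)} {ε : ℝ} (hε : 0 < ε) (hp : p ∈ F) (h : p + ε • v ∈ F) :
    v ∈ vectorSpan ℝ F := by
  have := vsub_mem_vectorSpan ℝ h hp
  simp only [vsub_eq_sub, add_sub_cancel_left] at this
  exact (Submodule.smul_mem_iff _ hε.ne').1 this

theorem finrank_ker_of_ne_zero {l : StrongDual ℝ (EuclideanSpace ℝ (Fin n))} (hl : l ≠ 0) :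
    Module.finrank ℝ (LinearMap.ker (l : EuclideanSpace ℝ (Fin n) →ₗ[ℝ] ℝ)) + 1 = n := by
  have h := Module.Dual.finrank_ker_add_one_of_ne_zero
    (f := (l : EuclideanSpace ℝ (Fin n) →ₗ[ℝ] ℝ))
    (fun h0 => hl (by ext1 x; exact DFunLike.congr_fun h0 x))
  simpa using h

theorem IsIrredundant.tightSet_isFacet {H : Finset (StrongDual ℝ (EuclideanSpace ℝ (Fin n)) × ℝ)}
    (hH : IsIrredundant H) {h : StrongDual ℝ (EuclideanSpace ℝ (Fin n)) × ℝ} (hh : h ∈ H) :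
    IsFacet (inequalitySet H) (tightSet (inequalitySet H) h) := by
  obtain ⟨h0, y, hy, hy'⟩ := hH h hh
  have hyP : y ∈ inequalitySet H := fun h' hh' => by
    by_cases e : h' = h
    · exact e ▸ hy.ge
    · exact (hy' h' hh' e).le
  refine ⟨⟨⟨y, hyP, hy⟩, fun _ => ⟨-h.1, ?_⟩⟩, ?_⟩
  · ext x
    simp only [tightSet, Set.mem_ofPred_eq, neg_apply, neg_le_neg_iff]
    refine and_congr_right fun hx => ⟨fun e z hz => e ▸ hz h hh, fun hx' => ?_⟩
    exact le_antisymm (hy ▸ hx' y hyP) (hx h hh)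
  · have : vectorSpan ℝ (tightSet (inequalitySet H) h) =
        LinearMap.ker (h.1 : EuclideanSpace ℝ (Fin n) →ₗ[ℝ] ℝ) := by
      refine le_antisymm (vectorSpan_le_ker fun x hx => hx.2) fun v hv => ?_
      have hv : h.1 v = 0 := hv
      obtain ⟨ε, hε, hm⟩ := eventually_add_smul_mem H (v := v) hyP fun h' hh' ht => by
        by_cases e : h' = h
        · rw [e, hv]
        · exact absurd ht (hy' h' hh' e).ne'
      exact mem_vectorSpan_of_add_smul_mem hε (p := y) ⟨hyP, hy⟩ ⟨hm, by simp [hv, hy]⟩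
    rw [affDim, this, finrank_ker_of_ne_zero h0]

theorem IsIrredundant.tightSet_injOn {H : Finset (StrongDual ℝ (EuclideanSpace ℝ (Fin n)) × ℝ)}
    (hH : IsIrredundant H) : Set.InjOn (tightSet (inequalitySet H)) H := by
  intro h hh h' hh' e
  by_contra hne
  obtain ⟨-, y, hy, hy'⟩ := hH h hh
  have hyP : y ∈ inequalitySet H := fun g hg => by
    by_cases e : g = h
    · exact e ▸ hy.ge
    · exact (hy' g hg e).le
  have : y ∈ tightSet (inequalitySet H) h' := e ▸ ⟨hyP, hy⟩
  exact (hy' h' hh' (Ne.symm hne)).ne' this.2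

/-- Every convex subset has a point at which only those inequalities are tight that are tight on the
whole subset. -/
theorem exists_generic_point {H : Finset (StrongDual ℝ (EuclideanSpace ℝ (Fin n)) × ℝ)}
    {F : Set (EuclideanSpace ℝ (Fin n))} (hF : F ⊆ inequalitySet H) (hne : F.Nonempty)
    (hc : Convex ℝ F) : ∃ p ∈ F, ∀ h ∈ H, h.1 p = h.2 → ∀ x ∈ F, h.1 x = h.2 := by
  classical
  suffices ∀ K ⊆ H, ∃ p ∈ F, ∀ h ∈ K, h.1 p = h.2 → ∀ x ∈ F, h.1 x = h.2 from
    this H subset_rfl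
  intro K
  induction K using Finset.induction_on with
  | empty => exact fun _ => ⟨hne.some, hne.some_mem, by simp⟩
  | insert g K _ ih =>
    intro hK
    obtain ⟨hg, hK'⟩ := Finset.insert_subset_iff.1 hK
    obtain ⟨p, hp, hp'⟩ := ih hK'
    by_cases hx : ∃ x ∈ F, g.1 x ≠ g.2
    · obtain ⟨x, hx, hxg⟩ := hx
      refine ⟨(1 / 2 : ℝ) • p + (1 / 2 : ℝ) • x,
        hc hp hx (by norm_num) (by norm_num) (by norm_num), fun h hh ht => ?_⟩
      have hhH : h ∈ H := hK hh
      have h1 := hF hp h hhH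
      have h2 := hF hx h hhH
      simp only [map_add, map_smul, smul_eq_mul] at ht
      rcases Finset.mem_insert.1 hh with rfl | hh
      · exact absurd (by linarith) hxg
      · exact hp' h hh (by linarith)
    · push Not at hx
      refine ⟨p, hp, fun h hh ht => ?_⟩
      rcases Finset.mem_insert.1 hh with rfl | hh
      · exact hx
      · exact hp' h hh ht

/-- The direction of a face is cut out by the inequalities that are tight at a generic point. -/
theorem mem_vectorSpan_face_iff {H : Finset (StrongDual ℝ (EuclideanSpace ℝ (Fin n)) × ℝ)}
    {F : Set (EuclideanSpace ℝ (Fin n))} (hF : IsFace (inequalitySet H) F)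
    {p : EuclideanSpace ℝ (Fin n)} (hp : p ∈ F)
    (hgen : ∀ h ∈ H, h.1 p = h.2 → ∀ x ∈ F, h.1 x = h.2) (v : EuclideanSpace ℝ (Fin n)) :
    v ∈ vectorSpan ℝ F ↔ ∀ h ∈ H, h.1 p = h.2 → h.1 v = 0 := by
  refine ⟨fun hv h hh ht => vectorSpan_le_ker (hgen h hh ht) hv, fun hv => ?_⟩
  obtain ⟨l, hl⟩ := hF.2 hF.1
  have hpP : p ∈ inequalitySet H := hF.2.subset hp
  -- Small steps along both `v` and `-v` stay in the polyhedron. The exposing functional `l` is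
  -- maximal at `p`, so it must vanish on `v`, and the step along `v` stays in `F`.
  obtain ⟨ε, hε, h1⟩ := eventually_add_smul_mem H hpP fun h hh ht => (hv h hh ht).ge
  obtain ⟨δ, hδ, h2⟩ := eventually_add_smul_mem H (v := -v) hpP
    fun h hh ht => by simp [hv h hh ht]
  have hpl : ∀ y ∈ inequalitySet H, l y ≤ l p := (hl.subset hp).2
  have h3 := hpl _ h1
  have h4 := hpl _ h2
  simp only [map_add, map_smul, map_neg, smul_eq_mul] at h3 h4
  have h5 : l v ≤ 0 := by
    by_contra! hcon
    have := mul_pos hε hcon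
    linarith
  have h6 : 0 ≤ l v := by
    by_contra! hcon
    have := mul_pos hδ (neg_pos.2 hcon)
    linarith
  have h7 : l v = 0 := le_antisymm h5 h6
  refine mem_vectorSpan_of_add_smul_mem hε hp ?_
  rw [hl]
  exact ⟨h1, fun y hy => by simpa [h7] using hpl y hy⟩

/-- Equal dimension forces equal directions, so the functional exposing `F` is constant on `F'` as
well, and all of `F'` attains its maximum. -/
theorem face_eq_of_affDim_eq {P F F' : Set (EuclideanSpace ℝ (Fin n))} (hF : IsFace P F)
    (hF' : F' ⊆ P) (hsub : F ⊆ F') (hdim : affDim F = affDim F') : F = F' := by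
  refine hsub.antisymm fun x hx => ?_
  obtain ⟨p, hp⟩ := hF.1
  obtain ⟨l, hl⟩ := hF.2 hF.1
  have hspan : vectorSpan ℝ F = vectorSpan ℝ F' :=
    Submodule.eq_of_le_of_finrank_eq (vectorSpan_mono ℝ hsub) hdim
  have hpl : ∀ y ∈ P, l y ≤ l p := (hl.subset hp).2
  have hconst : ∀ y ∈ F, l y = l p := fun y hy =>
    le_antisymm (hpl y (hF.2.subset hy)) ((hl.subset hy).2 p (hF.2.subset hp))
  have h1 : x - p ∈ vectorSpan ℝ F := hspan ▸ vsub_mem_vectorSpan ℝ hx (hsub hp)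
  have h2 : l (x - p) = 0 := vectorSpan_le_ker hconst h1
  rw [map_sub, sub_eq_zero] at h2
  rw [hl]
  exact ⟨hF' hx, fun y hy => h2 ▸ hpl y hy⟩

/-- The common zero set of `k` functionals has codimension at most `k`. -/
theorem le_card_add_finrank (A : Finset (StrongDual ℝ (EuclideanSpace ℝ (Fin n)) × ℝ))
    (W : Submodule ℝ (EuclideanSpace ℝ (Fin n))) (hW : ∀ v, (∀ h ∈ A, h.1 v = 0) → v ∈ W) :
    n ≤ A.card + Module.finrank ℝ W := by
  let φ : EuclideanSpace ℝ (Fin n) →ₗ[ℝ] (A → ℝ) :=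
    LinearMap.pi fun h => (h.1.1 : EuclideanSpace ℝ (Fin n) →ₗ[ℝ] ℝ)
  have h1 := φ.finrank_range_add_finrank_ker
  have h2 : Module.finrank ℝ (LinearMap.range φ) ≤ A.card :=
    (Submodule.finrank_le _).trans (by simp)
  have h3 : LinearMap.ker φ ≤ W := fun v hv => hW v fun h hh => by
    simpa [φ] using congrFun (LinearMap.mem_ker.1 hv) ⟨h, hh⟩
  have h4 := Submodule.finrank_mono h3
  simp only [finrank_euclideanSpace, Fintype.card_fin] at h1
  omega

theorem IsIrredundant.facet_eq_tightSet
    {H : Finset (StrongDual ℝ (EuclideanSpace ℝ (Fin n)) × ℝ)} (hH : IsIrredundant H)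
    {Q : Set (EuclideanSpace ℝ (Fin n))} (hQ : IsFacet (inequalitySet H) Q) :
    ∃ h ∈ H, Q = tightSet (inequalitySet H) h := by
  obtain ⟨p, hp, hgen⟩ := exists_generic_point hQ.1.2.subset hQ.1.1
    (hQ.1.2.convex (convex_inequalitySet H))
  obtain ⟨h, hh, ht⟩ : ∃ h ∈ H, h.1 p = h.2 := by
    by_contra! hcon
    have htop : vectorSpan ℝ Q = ⊤ := by
      rw [eq_top_iff]
      exact fun v _ => (mem_vectorSpan_face_iff hQ.1 hp hgen v).2
        fun h hh ht => absurd ht (hcon h hh)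
    have := hQ.2
    rw [affDim, htop] at this
    simp at this
  refine ⟨h, hh, face_eq_of_affDim_eq hQ.1 (fun x hx => hx.1)
    (fun x hx => ⟨hQ.1.2.subset hx, hgen h hh ht x hx⟩) ?_⟩
  have h1 := (hH.tightSet_isFacet hh).2
  have h2 := hQ.2
  omega

theorem finite_facets {P : Set (EuclideanSpace ℝ (Fin n))} (hP : IsSimplePolyhedron P) :
    {Q | IsFacet P Q}.Finite := by
  obtain ⟨H, rfl, hH⟩ := exists_irredundant hP.1 hP.2.1 hP.2.2.1
  refine (H.finite_toSet.image (tightSet (inequalitySet H))).subset fun Q hQ => ?_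
  obtain ⟨h, hh, rfl⟩ := hH.facet_eq_tightSet hQ
  exact ⟨h, hh, rfl⟩

theorem isFace_inter {P : Set (EuclideanSpace ℝ (Fin n))} {T : Set (Set (EuclideanSpace ℝ (Fin n)))}
    (hfin : T.Finite) (hT : ∀ Q ∈ T, IsFacet P Q) (hne : (P ∩ ⋂₀ T).Nonempty) :
    IsFace P (P ∩ ⋂₀ T) := by
  refine ⟨hne, ?_⟩
  induction T, hfin using Set.Finite.induction_on with
  | empty => simpa using IsExposed.refl P
  | @insert Q T _ _ ih =>
    have h1 : P ∩ ⋂₀ insert Q T = Q ∩ (P ∩ ⋂₀ T) := by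
      rw [Set.sInter_insert]
      exact Set.inter_left_comm _ _ _
    rw [h1] at hne ⊢
    exact (hT Q (Set.mem_insert _ _)).1.2.inter
      (ih (fun R hR => hT R (Set.mem_insert_of_mem _ hR)) (hne.mono Set.inter_subset_right))

/-- In a simple polyhedron, only the given facets contain a nonempty intersection of facets. -/
theorem IsSimplePolyhedron.facets_containing {P : Set (EuclideanSpace ℝ (Fin n))}
    (hP : IsSimplePolyhedron P) {T : Set (Set (EuclideanSpace ℝ (Fin n)))}
    (hT : ∀ Q ∈ T, IsFacet P Q) (hne : (P ∩ ⋂₀ T).Nonempty) :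
    {Q | IsFacet P Q ∧ P ∩ ⋂₀ T ⊆ Q} = T := by
  classical
  have hface := isFace_inter ((finite_facets hP).subset hT) hT hne
  have hsimple := hP.2.2.2 _ hface
  obtain ⟨H, hPH, hH⟩ := exists_irredundant hP.1 hP.2.1 hP.2.2.1
  subst hPH
  set P := inequalitySet H with hPdef
  set F := P ∩ ⋂₀ T with hFdef
  obtain ⟨p, hp, hgen⟩ := exists_generic_point (hface.2.subset) hface.1
    (hface.2.convex (convex_inequalitySet H))
  set A := H.filter fun h => h.1 p = h.2 with hA
  have hAT : {Q | IsFacet P Q ∧ F ⊆ Q} = tightSet P '' A := by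
    ext Q
    constructor
    · rintro ⟨hQ, hFQ⟩
      obtain ⟨h, hh, rfl⟩ := hH.facet_eq_tightSet hQ
      exact ⟨h, Finset.mem_coe.2 (Finset.mem_filter.2 ⟨hh, (hFQ hp).2⟩), rfl⟩
    · rintro ⟨h, hh, rfl⟩
      obtain ⟨hh, ht⟩ := Finset.mem_filter.1 (Finset.mem_coe.1 hh)
      exact ⟨hH.tightSet_isFacet hh, fun x hx => ⟨hface.2.subset hx, hgen h hh ht x hx⟩⟩
  have hcard : {Q | IsFacet P Q ∧ F ⊆ Q}.ncard = A.card := by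
    rw [hAT, Set.InjOn.ncard_image, Set.ncard_coe_finset]
    exact hH.tightSet_injOn.mono (Finset.coe_subset.2 (Finset.filter_subset _ _))
  refine subset_antisymm (fun Q hQ => ?_) fun Q hQ => ⟨hT Q hQ, fun x hx => hx.2 Q hQ⟩
  by_contra hQT
  obtain ⟨g, hg, rfl⟩ := hAT ▸ hQ
  -- Simplicity says that `A` has exactly as many members as the codimension of `F`, so no member
  -- can be omitted when cutting out the direction of `F`. If the facet of `g` is not in `T`, moving
  -- along `v` stays on every facet of `T`, hence in `F`, but leaves the facet of `g`.
  obtain ⟨v, hv, hgv⟩ : ∃ v, (∀ h ∈ A.erase g, h.1 v = 0) ∧ g.1 v ≠ 0 := by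
    by_contra! hcon
    have h1 := le_card_add_finrank (A.erase g) (vectorSpan ℝ F) fun v hv =>
      (mem_vectorSpan_face_iff hface hp hgen v).2 fun h hh ht => by
        by_cases e : h = g
        · exact e ▸ hcon v hv
        · exact hv h (Finset.mem_erase.2 ⟨e, Finset.mem_filter.2 ⟨hh, ht⟩⟩)
    have h2 := Finset.card_erase_lt_of_mem (Finset.mem_coe.1 hg)
    rw [hcard, affDim] at hsimple
    omega
  obtain ⟨w, hw, hgw⟩ : ∃ w, (∀ h ∈ A.erase g, h.1 w = 0) ∧ 0 < g.1 w :=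
    ⟨g.1 v • v, fun h hh => by simp [hv h hh], by simpa using mul_self_pos.2 hgv⟩
  obtain ⟨ε, hε, hm⟩ := eventually_add_smul_mem H (v := w) (hface.2.subset hp)
    fun h hh ht => by
      by_cases e : h = g
      · exact e ▸ hgw.le
      · exact (hw h (Finset.mem_erase.2 ⟨e, Finset.mem_filter.2 ⟨hh, ht⟩⟩)).ge
  have hmF : p + ε • w ∈ F := by
    refine ⟨hm, fun R hR => ?_⟩
    have hR' : R ∈ {Q | IsFacet P Q ∧ F ⊆ Q} := ⟨hT R hR, fun x hx => hx.2 R hR⟩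
    obtain ⟨h, hh, rfl⟩ := hAT ▸ hR'
    have hne : h ≠ g := fun e => hQT (e ▸ hR)
    refine ⟨hm, ?_⟩
    have h1 := hw h (Finset.mem_erase.2 ⟨hne, Finset.mem_coe.1 hh⟩)
    have h2 := (Finset.mem_filter.1 (Finset.mem_coe.1 hh)).2
    simp [h1, h2]
  have h1 := (hQ.2 hmF).2
  have h2 := (Finset.mem_filter.1 (Finset.mem_coe.1 hg)).2
  have h3 := mul_pos hε hgw
  simp only [map_add, map_smul, smul_eq_mul] at h1
  linarith

/-- In a simple polyhedron, every face is the intersection of the facets that contain it. -/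
theorem IsSimplePolyhedron.face_eq_inter {P F : Set (EuclideanSpace ℝ (Fin n))}
    (hP : IsSimplePolyhedron P) (hF : IsFace P F) :
    F = P ∩ ⋂₀ {Q | IsFacet P Q ∧ F ⊆ Q} := by
  set T := {Q | IsFacet P Q ∧ F ⊆ Q} with hT
  have hsub : F ⊆ P ∩ ⋂₀ T := fun x hx => ⟨hF.2.subset hx, fun Q hQ => hQ.2 hx⟩
  have hne : (P ∩ ⋂₀ T).Nonempty := hF.1.mono hsub
  have hTf : ∀ Q ∈ T, IsFacet P Q := fun Q hQ => hQ.1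
  have h1 := hP.2.2.2 F hF
  have h2 := hP.2.2.2 _ (isFace_inter ((finite_facets hP).subset hTf) hTf hne)
  rw [hP.facets_containing hTf hne] at h2
  exact face_eq_of_affDim_eq hF Set.inter_subset_left hsub (by rw [← hT] at h1; omega)

/-- A tubing goes to the intersection of its facets, within `P` so that the empty tubing gives `P`.
The tubing is recovered as the set of facets through this face, and simplicity turns their number
into the codimension. -/
theorem IsGraphAssociahedron.ncard_faces {V : Type*} [DecidableEq V] {G : DeltaGraph V}
    {P : Set (EuclideanSpace ℝ (Fin n))} (hP : IsGraphAssociahedron G P) {k : ℕ} (hk : k ≤ n) :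
    {F | IsFace P F ∧ affDim F = k}.ncard = G.tubingCount (n - k) := by
  classical
  obtain ⟨hS, e, he⟩ := hP
  let img : Finset (Finset V) → Set (Set (EuclideanSpace ℝ (Fin n))) := fun T =>
    {Q | ∃ t : {t // G.IsTube t}, t.1 ∈ T ∧ (e t : Set _) = Q}
  have himg : ∀ T, ∀ Q ∈ img T, IsFacet P Q := by
    rintro T _ ⟨t, -, rfl⟩
    exact (e t).2
  have hmap : ∀ T : Finset (Finset V), (∀ t ∈ T, G.IsTube t) →
      (T.subtype G.IsTube).map (Function.Embedding.subtype _) = T := fun T hT =>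
    Finset.subtype_map_of_mem hT
  have hinter : ∀ T : Finset (Finset V), P ∩ ⋂ t ∈ T.subtype G.IsTube, (e t : Set _) =
      P ∩ ⋂₀ img T := by
    intro T
    congr 1
    ext x
    simp only [Set.mem_iInter, Set.mem_sInter, Finset.mem_subtype]
    constructor
    · rintro h _ ⟨t, ht, rfl⟩
      exact h t ht
    · exact fun h t ht => h _ ⟨t, ht, rfl⟩
  have hne : ∀ T, G.IsTubing T → (P ∩ ⋂₀ img T).Nonempty := by
    intro T hT
    rw [← hinter, ← he, hmap T hT.1]
    exact hT
  have hcard : ∀ T, G.IsTubing T → (img T).ncard = T.card := by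
    intro T hT
    have : img T = (fun t => (e t : Set _)) '' (T.subtype G.IsTube : Set {t // G.IsTube t}) := by
      ext Q
      simp [img]
    have hinj : Function.Injective fun t => (e t : Set (EuclideanSpace ℝ (Fin n))) :=
      Subtype.val_injective.comp e.injective
    rw [this, Set.ncard_image_of_injective _ hinj,
      Set.ncard_coe_finset, ← Finset.card_map (Function.Embedding.subtype _), hmap T hT.1]
  have hdim : ∀ T, G.IsTubing T → T.card + affDim (P ∩ ⋂₀ img T) = n := by
    intro T hT
    have h1 := hS.2.2.2 _ (isFace_inter ((finite_facets hS).subset (himg T)) (himg T) (hne T hT))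
    rwa [hS.facets_containing (himg T) (hne T hT), hcard T hT] at h1
  symm
  refine Set.ncard_congr (fun T _ => P ∩ ⋂₀ img T) ?_ ?_ ?_
  · rintro T ⟨hT, hc⟩
    refine ⟨isFace_inter ((finite_facets hS).subset (himg T)) (himg T) (hne T hT), ?_⟩
    have := hdim T hT
    omega
  · rintro T T' ⟨hT, -⟩ ⟨hT', -⟩ heq
    have h1 : img T = img T' := by
      rw [← hS.facets_containing (himg T) (hne T hT),
        ← hS.facets_containing (himg T') (hne T' hT'), heq]
    have key : ∀ T T', G.IsTubing T → img T = img T' → T ⊆ T' := by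
      intro T T' hT h1 t ht
      have : (e ⟨t, hT.1 t ht⟩ : Set _) ∈ img T' := h1 ▸ ⟨⟨t, hT.1 t ht⟩, ht, rfl⟩
      obtain ⟨t', ht', h2⟩ := this
      have h3 : t'.1 = t := congrArg Subtype.val (e.injective (Subtype.ext h2))
      exact h3 ▸ ht'
    exact (key T T' hT h1).antisymm (key T' T hT' h1.symm)
  · rintro F ⟨hF, hFk⟩
    have hfin : {t : {t // G.IsTube t} | F ⊆ e t}.Finite := by
      have : Finite {F // IsFacet P F} := finite_facets hS
      have : Finite {t // G.IsTube t} := Finite.of_equiv _ e.symm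
      exact Set.toFinite _
    set T := hfin.toFinset.map (Function.Embedding.subtype _) with hT
    have hTt : ∀ t ∈ T, G.IsTube t := by
      intro t ht
      obtain ⟨s, -, rfl⟩ := Finset.mem_map.1 ht
      exact s.2
    have himgT : img T = {Q | IsFacet P Q ∧ F ⊆ Q} := by
      ext Q
      constructor
      · rintro ⟨t, ht, rfl⟩
        obtain ⟨s, hs, hst⟩ := Finset.mem_map.1 ht
        have : s = t := Subtype.ext hst
        exact ⟨(e t).2, by simpa [this] using hs⟩
      · rintro ⟨hQ, hFQ⟩
        refine ⟨e.symm ⟨Q, hQ⟩, ?_, by simp⟩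
        exact Finset.mem_map.2 ⟨e.symm ⟨Q, hQ⟩, by simpa using hFQ, rfl⟩
    have hF' : F = P ∩ ⋂₀ img T := himgT ▸ hS.face_eq_inter hF
    have htub : G.IsTubing T := by
      rw [← hmap T hTt, he, hinter, ← hF']
      exact hF.1
    refine ⟨T, ⟨htub, ?_⟩, hF'.symm⟩
    have := hdim T htub
    rw [← hF'] at this
    omega

theorem IsGraphAssociahedron.coeff_bivariateF {V : Type*} [DecidableEq V] {G : ℕ → DeltaGraph V}
    {P : Set (EuclideanSpace ℝ (Fin n))} (hP : IsGraphAssociahedron (G n) P) :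
    PowerSeries.coeff n (bivariateF G) = facePolynomial P := by
  rw [bivariateF, PowerSeries.coeff_mk, facePolynomial]
  refine Finset.sum_congr rfl fun k hk => ?_
  rw [hP.ncard_faces (Nat.lt_succ_iff.1 (Finset.mem_range.1 hk))]

end PolyhedronFaces

/-! ### Tubings with a prescribed union. -/

section CoverTubings

variable {V W : Type*}

/-- Two sets of vertices are disjoint and there is no edge between them. -/
def Separated (H : SimpleGraph V) (s t : Finset V) : Prop :=
  Disjoint s t ∧ ∀ u ∈ s, ∀ v ∈ t, ¬ H.Adj u v

theorem Separated.symm {H : SimpleGraph V} {s t : Finset V} (h : Separated H s t) :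
    Separated H t s :=
  ⟨h.1.symm, fun u hu v hv huv => h.2 v hv u hu huv.symm⟩

theorem Separated.mono {H : SimpleGraph V} {s t s' t' : Finset V} (h : Separated H s t)
    (hs : s' ⊆ s) (ht : t' ⊆ t) : Separated H s' t' :=
  ⟨h.1.mono hs ht, fun u hu v hv => h.2 u (hs hu) v (ht hv)⟩

theorem exists_adj_of_connected {H : SimpleGraph V} {σ : Finset V}
    (hσ : (H.induce (σ : Set V)).Connected) {S : Finset V} {u v : V} (hu : u ∈ σ) (hv : v ∈ σ)
    (huS : u ∈ S) (hvS : v ∉ S) : ∃ a ∈ σ, ∃ b ∈ σ, a ∈ S ∧ b ∉ S ∧ H.Adj a b := by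
  obtain ⟨p⟩ := hσ.preconnected ⟨u, hu⟩ ⟨v, hv⟩
  obtain ⟨d, -, h1, h2⟩ := p.exists_boundary_dart {x | x.1 ∈ S} huS hvS
  exact ⟨d.fst.1, d.fst.2, d.snd.1, d.snd.2, h1, h2, d.adj⟩

theorem nonempty_of_connected {H : SimpleGraph V} {t : Finset V}
    (ht : (H.induce (t : Set V)).Connected) : t.Nonempty := by
  obtain ⟨x⟩ := ht.nonempty
  exact ⟨x.1, x.2⟩

variable [DecidableEq V] [DecidableEq W]

/-- A tubing of the graph `H` with union `σ`. -/
structure IsCoverTubing (H : SimpleGraph V) (σ : Finset V) (T : Finset (Finset V)) : Prop where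
  connected : ∀ t ∈ T, (H.induce (t : Set V)).Connected
  compatible : ∀ s ∈ T, ∀ t ∈ T, s ⊆ t ∨ t ⊆ s ∨ Separated H s t
  biUnion_eq : T.biUnion id = σ

theorem DeltaGraph.isTubing_iff (G : DeltaGraph V) (T : Finset (Finset V)) :
    G.IsTubing T ↔ ∃ σ ∈ G.faces, IsCoverTubing G.graph σ T := by
  constructor
  · rintro ⟨h1, h2, h3⟩
    refine ⟨_, h3, fun t ht => (h1 t ht).2, fun s hs t ht => ?_, rfl⟩
    by_cases e : s = t
    · exact Or.inl e.subset
    · exact h2 hs ht e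
  · rintro ⟨σ, hσ, h⟩
    refine ⟨fun t ht => ⟨G.down_closed σ hσ t ?_, h.connected t ht⟩,
      fun s hs t ht _ => h.compatible s hs t ht, h.biUnion_eq.symm ▸ hσ⟩
    rw [← h.biUnion_eq]
    exact Finset.subset_biUnion_of_mem id ht

namespace IsCoverTubing

variable {H : SimpleGraph V} {σ : Finset V} {T : Finset (Finset V)}

theorem subset (h : IsCoverTubing H σ T) {t : Finset V} (ht : t ∈ T) : t ⊆ σ := by
  rw [← h.biUnion_eq]
  exact Finset.subset_biUnion_of_mem id ht

theorem exists_mem (h : IsCoverTubing H σ T) {v : V} (hv : v ∈ σ) : ∃ t ∈ T, v ∈ t := by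
  rw [← h.biUnion_eq] at hv
  simpa using hv

theorem of_subset (h : IsCoverTubing H σ T) {U : Finset (Finset V)} (hU : U ⊆ T) {τ : Finset V}
    (hτ : U.biUnion id = τ) : IsCoverTubing H τ U :=
  ⟨fun t ht => h.connected t (hU ht), fun s hs t ht => h.compatible s (hU hs) t (hU ht), hτ⟩

/-- A tubing whose union is connected contains its union. -/
theorem self_mem (h : IsCoverTubing H σ T) (hσ : (H.induce (σ : Set V)).Connected) : σ ∈ T := by
  obtain ⟨v, hv⟩ := nonempty_of_connected hσ
  obtain ⟨t₀, ht₀, -⟩ := h.exists_mem hv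
  -- If a maximal tube is not all of σ, some edge inside σ leaves it. The tube covering the outer
  -- endpoint is compatible with `t` in none of the three ways.
  obtain ⟨t, ht⟩ := T.exists_maximal ⟨t₀, ht₀⟩
  by_contra hne
  have htσ : t ≠ σ := fun e => hne (e ▸ ht.1)
  obtain ⟨w, hw, hwt⟩ := Finset.exists_of_ssubset ((h.subset ht.1).ssubset_of_ne htσ)
  obtain ⟨u, hu⟩ := nonempty_of_connected (h.connected t ht.1)
  obtain ⟨a, -, b, hb, hat, hbt, hab⟩ :=
    exists_adj_of_connected hσ (h.subset ht.1 hu) hw hu hwt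
  obtain ⟨s, hs, hbs⟩ := h.exists_mem hb
  rcases h.compatible t ht.1 s hs with h1 | h1 | h1
  · exact hbt (ht.2 hs h1 hbs)
  · exact hbt (h1 hbs)
  · exact h1.2 a hat b hbs hab

/-- Removing a maximal tube `t` strictly shrinks the union: otherwise the remaining tubes inside `t`
would cover `t`, and by `self_mem` one of them would equal `t`. This bound makes the truncated
subtractions in the exponents below genuine. -/
theorem card_le (h : IsCoverTubing H σ T) : T.card ≤ σ.card := by
  induction hk : T.card generalizing σ T with
  | zero => exact Nat.zero_le _
  | succ k ih =>
    obtain ⟨t, ht⟩ := T.exists_maximal (Finset.card_pos.1 (by omega))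
    have hle := ih (h.of_subset (Finset.erase_subset t T) rfl)
      (by rw [Finset.card_erase_of_mem ht.1, hk]; rfl)
    refine Nat.succ_le_of_lt (hle.trans_lt (Finset.card_lt_card ?_))
    have hsub : (T.erase t).biUnion id ⊆ σ := by
      rw [← h.biUnion_eq]
      exact Finset.biUnion_subset_biUnion_of_subset_left _ (Finset.erase_subset t T)
    refine hsub.ssubset_of_ne fun e => ?_
    have hcov : IsCoverTubing H t ((T.erase t).filter (· ⊆ t)) := by
      refine h.of_subset ((Finset.filter_subset _ _).trans (Finset.erase_subset t T)) ?_
      refine subset_antisymm (Finset.biUnion_subset.2 fun s hs => (Finset.mem_filter.1 hs).2) ?_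
      intro v hv
      obtain ⟨s, hs, hvs⟩ := Finset.mem_biUnion.1 (e.symm ▸ h.subset ht.1 hv)
      obtain ⟨hst, hsT⟩ := Finset.mem_erase.1 hs
      refine Finset.mem_biUnion.2 ⟨s, Finset.mem_filter.2 ⟨hs, ?_⟩, hvs⟩
      rcases h.compatible s hsT t ht.1 with h1 | h1 | h1
      · exact h1
      · exact ht.2 hsT h1
      · exact absurd hv (Finset.disjoint_left.1 h1.1 hvs)
    have := hcov.self_mem (h.connected t ht.1)
    simp at this

theorem image (h : IsCoverTubing H σ T) {H' : SimpleGraph W} {f : V → W}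
    (hf : Set.InjOn f σ) (hadj : ∀ u ∈ σ, ∀ v ∈ σ, H.Adj u v ↔ H'.Adj (f u) (f v)) :
    IsCoverTubing H' (σ.image f) (T.image (Finset.image f)) := by
  refine ⟨fun t' ht' => ?_, fun s' hs' t' ht' => ?_, ?_⟩
  · obtain ⟨t, ht, rfl⟩ := Finset.mem_image.1 ht'
    let φ : H.induce (t : Set V) →g H'.induce ((t.image f : Finset W) : Set W) :=
      { toFun := fun v => ⟨f v.1, Finset.mem_coe.2 (Finset.mem_image_of_mem f v.2)⟩
        map_rel' := fun {u v} huv =>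
          (hadj u.1 (h.subset ht u.2) v.1 (h.subset ht v.2)).1 huv }
    refine (h.connected t ht).map φ ?_
    rintro ⟨w, hw⟩
    obtain ⟨v, hv, rfl⟩ := Finset.mem_image.1 (Finset.mem_coe.1 hw)
    exact ⟨⟨v, hv⟩, rfl⟩
  · obtain ⟨s, hs, rfl⟩ := Finset.mem_image.1 hs'
    obtain ⟨t, ht, rfl⟩ := Finset.mem_image.1 ht'
    rcases h.compatible s hs t ht with h1 | h1 | h1
    · exact Or.inl (Finset.image_subset_image h1)
    · exact Or.inr (Or.inl (Finset.image_subset_image h1))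
    · refine Or.inr (Or.inr ⟨Finset.disjoint_left.2 fun x hx hx' => ?_, fun u' hu v' hv => ?_⟩)
      · obtain ⟨u, hu, rfl⟩ := Finset.mem_image.1 hx
        obtain ⟨v, hv, e⟩ := Finset.mem_image.1 hx'
        have := hf (h.subset ht hv) (h.subset hs hu) e
        exact Finset.disjoint_left.1 h1.1 hu (this ▸ hv)
      · obtain ⟨u, hus, rfl⟩ := Finset.mem_image.1 hu
        obtain ⟨v, hvt, rfl⟩ := Finset.mem_image.1 hv
        rw [← hadj u (h.subset hs hus) v (h.subset ht hvt)]
        exact h1.2 u hus v hvt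
  · rw [Finset.image_biUnion, ← h.biUnion_eq, Finset.biUnion_image]
    rfl

end IsCoverTubing

open Classical in
/-- The tubings of `H` with union `σ`. -/
noncomputable def coverTubings (H : SimpleGraph V) (σ : Finset V) : Finset (Finset (Finset V)) :=
  σ.powerset.powerset.filter (IsCoverTubing H σ)

@[simp]
theorem mem_coverTubings {H : SimpleGraph V} {σ : Finset V} {T : Finset (Finset V)} :
    T ∈ coverTubings H σ ↔ IsCoverTubing H σ T := by
  simp only [coverTubings, Finset.mem_filter, Finset.mem_powerset, and_iff_right_iff_imp]
  exact fun h t ht => Finset.mem_powerset.2 (h.subset ht)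

theorem pairwiseDisjoint_coverTubings (H : SimpleGraph V) (S : Set (Finset V)) :
    S.PairwiseDisjoint (coverTubings H) := by
  intro σ _ τ _ hne
  refine Finset.disjoint_left.2 fun T h1 h2 => hne ?_
  rw [← (mem_coverTubings.1 h1).biUnion_eq, (mem_coverTubings.1 h2).biUnion_eq]

/-- The generating polynomial of the tubings with union `σ` by the defect of their number of
tubes. -/
noncomputable def coverPoly (H : SimpleGraph V) (σ : Finset V) : ℚ[X] :=
  ∑ T ∈ coverTubings H σ, Polynomial.X ^ (σ.card - T.card)

theorem coverPoly_empty (H : SimpleGraph V) : coverPoly H ∅ = 1 := by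
  have : coverTubings H ∅ = {∅} := by
    ext T
    rw [mem_coverTubings, Finset.mem_singleton]
    constructor
    · intro h
      exact Finset.card_eq_zero.1 (Nat.le_zero.1 h.card_le)
    · rintro rfl
      exact ⟨by simp, by simp, by simp⟩
  simp [coverPoly, this]

/-- Adjacency is compared only inside σ. This is what allows each face to be laid out on a line
although the whole Δ-graph is not an induced subgraph of the line. -/
theorem coverPoly_image [Nonempty V] {H : SimpleGraph V} {H' : SimpleGraph W} {σ : Finset V}
    {f : V → W} (hf : Set.InjOn f σ) (hadj : ∀ u ∈ σ, ∀ v ∈ σ, H.Adj u v ↔ H'.Adj (f u) (f v)) :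
    coverPoly H' (σ.image f) = coverPoly H σ := by
  obtain ⟨g, hg⟩ : ∃ g : W → V, ∀ v ∈ σ, g (f v) = v :=
    ⟨Function.invFunOn f σ, fun v hv => hf.leftInvOn_invFunOn hv⟩
  have hgf : ∀ t ⊆ σ, (t.image f).image g = t := fun t ht => by
    rw [Finset.image_image]
    exact (Finset.image_congr fun v hv => hg v (ht hv)).trans Finset.image_id
  have hfg : ∀ w ∈ σ.image f, f (g w) = w := fun w hw => by
    obtain ⟨v, hv, rfl⟩ := Finset.mem_image.1 hw
    rw [hg v hv]
  have hfg' : ∀ t ⊆ σ.image f, (t.image g).image f = t := fun t ht => by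
    rw [Finset.image_image]
    exact (Finset.image_congr fun w hw => hfg w (ht hw)).trans Finset.image_id
  have hcard : ∀ T ∈ coverTubings H σ, (T.image (Finset.image f)).card = T.card := by
    intro T hT
    refine Finset.card_image_of_injOn fun s hs t ht e => ?_
    rw [← hgf s ((mem_coverTubings.1 hT).subset hs), ← hgf t ((mem_coverTubings.1 hT).subset ht)]
    exact congrArg _ e
  symm
  refine Finset.sum_nbij' (fun T => T.image (Finset.image f)) (fun T => T.image (Finset.image g))
    ?_ ?_ ?_ ?_ ?_
  · exact fun T hT => mem_coverTubings.2 ((mem_coverTubings.1 hT).image hf hadj)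
  · intro T hT
    have := (mem_coverTubings.1 hT).image (H' := H) (f := g)
      (fun a ha b hb e => by rw [← hfg a ha, ← hfg b hb, e]) fun u hu v hv => by
        obtain ⟨u, huσ, rfl⟩ := Finset.mem_image.1 hu
        obtain ⟨v, hvσ, rfl⟩ := Finset.mem_image.1 hv
        rw [hg u huσ, hg v hvσ, hadj u huσ v hvσ]
    rw [hgf σ subset_rfl] at this
    exact mem_coverTubings.2 this
  · intro T hT
    simp only [Finset.image_image]
    exact (Finset.image_congr fun t ht =>
      hgf t ((mem_coverTubings.1 hT).subset ht)).trans Finset.image_id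
  · intro T hT
    simp only [Finset.image_image]
    exact (Finset.image_congr fun t ht =>
      hfg' t ((mem_coverTubings.1 hT).subset ht)).trans Finset.image_id
  · intro T hT
    rw [hcard T hT, Finset.card_image_of_injOn hf]

theorem coverPoly_congr [Nonempty V] {H H' : SimpleGraph V} {σ : Finset V}
    (hadj : ∀ u ∈ σ, ∀ v ∈ σ, H.Adj u v ↔ H'.Adj u v) : coverPoly H' σ = coverPoly H σ := by
  simpa using coverPoly_image (f := id) (Set.injOn_id _) hadj

theorem subset_or_subset_of_connected {H : SimpleGraph V} {σ τ t : Finset V}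
    (hsep : Separated H σ τ) (ht : (H.induce (t : Set V)).Connected) (hsub : t ⊆ σ ∪ τ) :
    t ⊆ σ ∨ t ⊆ τ := by
  by_contra! hcon
  obtain ⟨v, hv, hvσ⟩ := Finset.not_subset.1 hcon.1
  obtain ⟨u, hu, huτ⟩ := Finset.not_subset.1 hcon.2
  have huσ : u ∈ σ := (Finset.mem_union.1 (hsub hu)).resolve_right huτ
  obtain ⟨a, -, b, hb, haσ, hbσ, hab⟩ := exists_adj_of_connected ht hu hv huσ hvσ
  exact hsep.2 a haσ b ((Finset.mem_union.1 (hsub hb)).resolve_left hbσ) hab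

theorem IsCoverTubing.filter_left {H : SimpleGraph V} {σ τ : Finset V} (hsep : Separated H σ τ)
    {T : Finset (Finset V)} (hT : IsCoverTubing H (σ ∪ τ) T) :
    IsCoverTubing H σ (T.filter (· ⊆ σ)) := by
  refine hT.of_subset (Finset.filter_subset _ _) (subset_antisymm
    (Finset.biUnion_subset.2 fun s hs => (Finset.mem_filter.1 hs).2) fun v hv => ?_)
  obtain ⟨t, ht, hvt⟩ := hT.exists_mem (Finset.mem_union_left τ hv)
  refine Finset.mem_biUnion.2 ⟨t, Finset.mem_filter.2 ⟨ht, ?_⟩, hvt⟩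
  exact (subset_or_subset_of_connected hsep (hT.connected t ht) (hT.subset ht)).resolve_right
    fun h => Finset.disjoint_left.1 hsep.1 hv (h hvt)

theorem IsCoverTubing.union {H : SimpleGraph V} {σ τ : Finset V} (hsep : Separated H σ τ)
    {T U : Finset (Finset V)} (hT : IsCoverTubing H σ T) (hU : IsCoverTubing H τ U) :
    IsCoverTubing H (σ ∪ τ) (T ∪ U) := by
  refine ⟨fun t ht => ?_, fun s hs t ht => ?_, ?_⟩
  · exact (Finset.mem_union.1 ht).elim (hT.connected t) (hU.connected t)
  · rcases Finset.mem_union.1 hs with hs | hs <;> rcases Finset.mem_union.1 ht with ht | ht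
    · exact hT.compatible s hs t ht
    · exact Or.inr (Or.inr (hsep.mono (hT.subset hs) (hU.subset ht)))
    · exact Or.inr (Or.inr (hsep.symm.mono (hU.subset hs) (hT.subset ht)))
    · exact hU.compatible s hs t ht
  · rw [Finset.union_biUnion, hT.biUnion_eq, hU.biUnion_eq]

theorem IsCoverTubing.filter_union {H : SimpleGraph V} {σ τ : Finset V} (hsep : Separated H σ τ)
    {T U : Finset (Finset V)} (hT : IsCoverTubing H σ T) (hU : IsCoverTubing H τ U) :
    (T ∪ U).filter (· ⊆ σ) = T := by
  ext t
  simp only [Finset.mem_filter, Finset.mem_union]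
  refine ⟨fun ⟨h, hσ⟩ => h.resolve_right fun ht => ?_, fun h => ⟨Or.inl h, hT.subset h⟩⟩
  obtain ⟨v, hv⟩ := nonempty_of_connected (hU.connected t ht)
  exact Finset.disjoint_left.1 hsep.1 (hσ hv) (hU.subset ht hv)

/-- No connected set crosses a separation, so a tubing with union σ ∪ τ is uniquely a tubing of each
part, and the defects add. -/
theorem coverPoly_union {H : SimpleGraph V} {σ τ : Finset V} (hsep : Separated H σ τ) :
    coverPoly H (σ ∪ τ) = coverPoly H σ * coverPoly H τ := by
  rw [coverPoly, coverPoly, coverPoly, Finset.sum_mul_sum, ← Finset.sum_product']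
  symm
  refine Finset.sum_nbij' (fun p => p.1 ∪ p.2) (fun T => (T.filter (· ⊆ σ), T.filter (· ⊆ τ)))
    ?_ ?_ ?_ ?_ ?_
  · rintro ⟨T, U⟩ h
    simp only [Finset.mem_product, mem_coverTubings] at h ⊢
    exact h.1.union hsep h.2
  · intro T hT
    rw [mem_coverTubings] at hT
    simp only [Finset.mem_product, mem_coverTubings]
    exact ⟨hT.filter_left hsep, (Finset.union_comm σ τ ▸ hT).filter_left hsep.symm⟩
  · rintro ⟨T, U⟩ h
    simp only [Finset.mem_product, mem_coverTubings] at h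
    refine Prod.ext (h.1.filter_union hsep h.2) ?_
    rw [Finset.union_comm]
    exact h.2.filter_union hsep.symm h.1
  · intro T hT
    rw [mem_coverTubings] at hT
    rw [← Finset.filter_or, Finset.filter_eq_self]
    exact fun t ht => subset_or_subset_of_connected hsep (hT.connected t ht) (hT.subset ht)
  · rintro ⟨T, U⟩ h
    simp only [Finset.mem_product, mem_coverTubings] at h
    have hd : Disjoint T U := by
      refine Finset.disjoint_left.2 fun t h1 h2 => ?_
      obtain ⟨v, hv⟩ := nonempty_of_connected (h.1.connected t h1)
      exact Finset.disjoint_left.1 hsep.1 (h.1.subset h1 hv) (h.2.subset h2 hv)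
    have h1 := h.1.card_le
    have h2 := h.2.card_le
    rw [Finset.card_union_of_disjoint hd, Finset.card_union_of_disjoint hsep.1, ← pow_add]
    dsimp only
    congr 1
    omega

/-- Removing the largest tube. -/
theorem coverPoly_of_connected {H : SimpleGraph V} {σ : Finset V}
    (hσ : (H.induce (σ : Set V)).Connected) :
    coverPoly H σ =
      ∑ τ ∈ σ.ssubsets, Polynomial.X ^ (σ.card - 1 - τ.card) * coverPoly H τ := by
  have hnot : ∀ τ ∈ σ.ssubsets, ∀ T, IsCoverTubing H τ T → σ ∉ T := fun τ hτ T hT hmem =>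
    (Finset.mem_ssubsets.1 hτ).2 (hT.subset hmem)
  have h1 : coverPoly H σ =
      ∑ T ∈ σ.ssubsets.biUnion (coverTubings H), Polynomial.X ^ (σ.card - 1 - T.card) := by
    -- Connectedness puts σ into every tubing that covers it. Once σ is erased, the rest can no
    -- longer cover σ, for it would then contain σ again.
    refine Finset.sum_nbij' (fun T => T.erase σ) (insert σ) ?_ ?_ ?_ ?_ ?_
    · intro T hT
      rw [mem_coverTubings] at hT
      have hsub : (T.erase σ).biUnion id ⊆ σ := by
        refine Finset.biUnion_subset.2 fun t ht => hT.subset (Finset.mem_of_mem_erase ht)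
      refine Finset.mem_biUnion.2 ⟨_, Finset.mem_ssubsets.2 (hsub.ssubset_of_ne fun e => ?_),
        mem_coverTubings.2 (hT.of_subset (Finset.erase_subset σ T) rfl)⟩
      exact Finset.notMem_erase σ T ((hT.of_subset (Finset.erase_subset σ T) e).self_mem hσ)
    · intro T hT
      obtain ⟨τ, hτ, hT⟩ := Finset.mem_biUnion.1 hT
      rw [mem_coverTubings] at hT ⊢
      have hle : ∀ t ∈ insert σ T, t ⊆ σ := fun t ht => by
        rcases Finset.mem_insert.1 ht with rfl | ht
        · exact subset_rfl
        · exact (hT.subset ht).trans (Finset.mem_ssubsets.1 hτ).1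
      refine ⟨fun t ht => ?_, fun s hs t ht => ?_, ?_⟩
      · rcases Finset.mem_insert.1 ht with rfl | ht
        · exact hσ
        · exact hT.connected t ht
      · rcases Finset.mem_insert.1 hs with rfl | hs'
        · exact Or.inr (Or.inl (hle t ht))
        · rcases Finset.mem_insert.1 ht with rfl | ht'
          · exact Or.inl (hle s hs)
          · exact hT.compatible s hs' t ht'
      · exact subset_antisymm (Finset.biUnion_subset.2 hle)
          (Finset.subset_biUnion_of_mem id (Finset.mem_insert_self σ T))
    · intro T hT
      exact Finset.insert_erase ((mem_coverTubings.1 hT).self_mem hσ)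
    · intro T hT
      obtain ⟨τ, hτ, hT⟩ := Finset.mem_biUnion.1 hT
      exact Finset.erase_insert (hnot τ hτ T (mem_coverTubings.1 hT))
    · intro T hT
      have h2 := (mem_coverTubings.1 hT).self_mem hσ
      have h3 := Finset.card_pos.2 ⟨σ, h2⟩
      rw [Finset.card_erase_of_mem h2]
      congr 1
      omega
  rw [h1, Finset.sum_biUnion (pairwiseDisjoint_coverTubings H _)]
  refine Finset.sum_congr rfl fun τ hτ => ?_
  rw [coverPoly, Finset.mul_sum]
  refine Finset.sum_congr rfl fun T hT => ?_
  have h2 := (mem_coverTubings.1 hT).card_le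
  have h3 := Finset.card_lt_card (Finset.mem_ssubsets.1 hτ)
  rw [← pow_add]
  congr 1
  omega

/-- For a tubing `T` with union σ the exponent splits as n - |T| = (n - |σ|) + (|σ| - |T|). -/
theorem coeff_bivariateF_eq_sum {G : ℕ → DeltaGraph V} {n : ℕ} {S : Finset (Finset V)}
    (hS : ∀ σ, σ ∈ S ↔ σ ∈ (G n).faces) (hcard : ∀ σ ∈ S, σ.card ≤ n) :
    PowerSeries.coeff n (bivariateF G) =
      ∑ σ ∈ S, Polynomial.X ^ (n - σ.card) * coverPoly (G n).graph σ := by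
  set U := S.biUnion (coverTubings (G n).graph) with hU
  have hmem : ∀ T, T ∈ U ↔ (G n).IsTubing T := fun T => by
    simp [hU, DeltaGraph.isTubing_iff, hS]
  have hUcard : ∀ T ∈ U, T.card ≤ n := fun T hT => by
    obtain ⟨σ, hσ, hT⟩ := Finset.mem_biUnion.1 hT
    exact (mem_coverTubings.1 hT).card_le.trans (hcard σ hσ)
  have h1 : PowerSeries.coeff n (bivariateF G) = ∑ T ∈ U, (Polynomial.X : ℚ[X]) ^ (n - T.card) := by
    rw [bivariateF, PowerSeries.coeff_mk, ← Finset.sum_fiberwise_of_maps_to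
      (g := fun T : Finset (Finset V) => n - T.card) (t := Finset.range (n + 1))
      (fun T _ => Finset.mem_range.2 (by omega))]
    refine Finset.sum_congr rfl fun k hk => ?_
    have h2 : {T | (G n).IsTubing T ∧ T.card = n - k} =
        (U.filter fun T => n - T.card = k : Finset (Finset (Finset V))) := by
      ext T
      simp only [Set.mem_ofPred_eq, Finset.coe_filter, hmem]
      refine and_congr_right fun hT => ?_
      have := hUcard T ((hmem T).2 hT)
      have := Finset.mem_range.1 hk
      omega
    rw [DeltaGraph.tubingCount, h2, Set.ncard_coe_finset,
      Finset.sum_congr rfl fun T hT => by rw [(Finset.mem_filter.1 hT).2], Finset.sum_const,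
      ← Polynomial.C_mul_X_pow_eq_monomial]
    simp
  rw [h1, hU, Finset.sum_biUnion (pairwiseDisjoint_coverTubings _ _)]
  refine Finset.sum_congr rfl fun σ hσ => ?_
  rw [coverPoly, Finset.mul_sum]
  refine Finset.sum_congr rfl fun T hT => ?_
  have h2 := (mem_coverTubings.1 hT).card_le
  have h3 := hcard σ hσ
  rw [← pow_add]
  congr 1
  omega

end CoverTubings

/-! ### Tubings of the infinite path. -/

section LineGraph

/-- The infinite path on `ℤ`. -/
def lineGraph : SimpleGraph ℤ where
  Adj u v := v = u + 1 ∨ u = v + 1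
  symm := ⟨fun _ _ h => h.symm⟩
  loopless := ⟨fun _ h => by omega⟩

theorem lineGraph_adj {u v : ℤ} : lineGraph.Adj u v ↔ v = u + 1 ∨ u = v + 1 := Iff.rfl

theorem connected_lineGraph_Icc (n : ℕ) :
    (lineGraph.induce ((Finset.Icc (1 : ℤ) (n + 1) : Finset ℤ) : Set ℤ)).Connected := by
  have hmem : ∀ k : ℕ, k ≤ n → (1 + k : ℤ) ∈ ((Finset.Icc (1 : ℤ) (n + 1) : Finset ℤ) : Set ℤ) :=
    fun k hk => by simp; omega
  have hreach : ∀ (k : ℕ) (hk : k ≤ n),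
      (lineGraph.induce ((Finset.Icc (1 : ℤ) (n + 1) : Finset ℤ) : Set ℤ)).Reachable
        ⟨1 + (0 : ℕ), hmem 0 (Nat.zero_le n)⟩ ⟨1 + k, hmem k hk⟩ := by
    intro k
    induction k with
    | zero => exact fun _ => SimpleGraph.Reachable.refl _
    | succ k ih =>
      intro hk
      refine (ih (by omega)).trans (SimpleGraph.Adj.reachable ?_)
      rw [SimpleGraph.induce_adj, lineGraph_adj]
      push_cast
      omega
  rw [SimpleGraph.connected_iff_exists_forall_reachable]
  refine ⟨⟨1 + (0 : ℕ), hmem 0 (Nat.zero_le n)⟩, fun ⟨w, hw⟩ => ?_⟩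
  have hw' := Finset.mem_Icc.1 (Finset.mem_coe.1 hw)
  obtain ⟨k, rfl⟩ : ∃ k : ℕ, w = 1 + k := ⟨(w - 1).toNat, by omega⟩
  exact hreach k (by omega)

/-- The polynomial of the tubings of the infinite path with union `σ`. -/
noncomputable def linePoly (σ : Finset ℤ) : ℚ[X] := coverPoly lineGraph σ

/-- The polynomial of the tubings of a path with `j` vertices whose union is the whole path. -/
noncomputable def pathPoly (j : ℕ) : ℚ[X] := linePoly (Finset.Icc 1 j)

theorem linePoly_union {σ τ : Finset ℤ} (h : ∀ u ∈ σ, ∀ v ∈ τ, u + 1 < v) :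
    linePoly (σ ∪ τ) = linePoly σ * linePoly τ := by
  refine coverPoly_union ⟨Finset.disjoint_left.2 fun u hu hv => ?_, fun u hu v hv => ?_⟩
  · have := h u hu u hv
    omega
  · have := h u hu v hv
    rw [lineGraph_adj]
    omega

theorem linePoly_add (σ : Finset ℤ) (d : ℤ) : linePoly (σ.image (· + d)) = linePoly σ :=
  coverPoly_image (add_left_injective d).injOn fun u _ v _ => by
    simp only [lineGraph_adj]
    omega

theorem linePoly_Icc {a c : ℤ} {j : ℕ} (h : c + 1 = a + j) :
    linePoly (Finset.Icc a c) = pathPoly j := by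
  rw [pathPoly, ← linePoly_add (Finset.Icc 1 (j : ℤ)) (a - 1), Finset.image_add_right_Icc]
  congr 2 <;> omega

theorem linePoly_empty : linePoly ∅ = 1 := coverPoly_empty _

theorem pathPoly_zero : pathPoly 0 = 1 := by
  simp [pathPoly, linePoly_empty]

theorem pathPoly_succ (n : ℕ) : pathPoly (n + 1) =
    ∑ τ ∈ (Finset.Icc (1 : ℤ) (n + 1)).ssubsets, Polynomial.X ^ (n - τ.card) * linePoly τ := by
  have h := coverPoly_of_connected (connected_lineGraph_Icc n)
  simpa [pathPoly, linePoly] using h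

/-- The Catalan recursion. At x = 0 only the subsets missing a single vertex survive in
`pathPoly_succ`, and such a vertex cuts the path into two paths with n vertices in all. -/
theorem eval_pathPoly_succ (n : ℕ) : (pathPoly (n + 1)).eval 0 =
    ∑ p ∈ Finset.HasAntidiagonal.antidiagonal n, (pathPoly p.1).eval 0 * (pathPoly p.2).eval 0 := by
  set s : Finset ℤ := Finset.Icc (1 : ℤ) (n + 1) with hs
  have hcard : s.card = n + 1 := by simp [hs]
  have hmem : ∀ p ∈ Finset.HasAntidiagonal.antidiagonal n, (p.1 + 1 : ℤ) ∈ s := fun p hp => by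
    have := Finset.HasAntidiagonal.mem_antidiagonal.1 hp
    simp only [hs, Finset.mem_Icc]
    omega
  have hsub : (Finset.HasAntidiagonal.antidiagonal n).image (fun p => s.erase (p.1 + 1 : ℤ)) ⊆
      s.ssubsets := by
    intro τ hτ
    obtain ⟨p, hp, rfl⟩ := Finset.mem_image.1 hτ
    exact Finset.mem_ssubsets.2 (Finset.erase_ssubset (hmem p hp))
  rw [pathPoly_succ, Polynomial.eval_finsetSum, ← Finset.sum_subset hsub, Finset.sum_image]
  · refine Finset.sum_congr rfl fun p hp => ?_
    have hp' := Finset.HasAntidiagonal.mem_antidiagonal.1 hp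
    have hc : (s.erase (p.1 + 1 : ℤ)).card = n := by
      rw [Finset.card_erase_of_mem (hmem p hp), hcard]
      rfl
    have he : s.erase (p.1 + 1 : ℤ) =
        Finset.Icc 1 (p.1 : ℤ) ∪ Finset.Icc (p.1 + 2 : ℤ) (n + 1) := by
      ext v
      simp only [hs, Finset.mem_erase, Finset.mem_union, Finset.mem_Icc]
      omega
    rw [hc, Nat.sub_self, pow_zero, one_mul, he, linePoly_union, Polynomial.eval_mul,
      linePoly_Icc (a := p.1 + 2) (j := p.2) (by omega), ← pathPoly]
    intro u hu v hv
    rw [Finset.mem_Icc] at hu hv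
    omega
  · intro p hp r hr e
    have hp' := Finset.HasAntidiagonal.mem_antidiagonal.1 (Finset.mem_coe.1 hp)
    have hr' := Finset.HasAntidiagonal.mem_antidiagonal.1 (Finset.mem_coe.1 hr)
    have : (p.1 + 1 : ℤ) = r.1 + 1 := by
      by_contra hne
      have h1 : (p.1 + 1 : ℤ) ∈ s.erase (r.1 + 1 : ℤ) :=
        Finset.mem_erase.2 ⟨hne, hmem p hp⟩
      have h2 : s.erase (p.1 + 1 : ℤ) = s.erase (r.1 + 1 : ℤ) := e
      rw [← h2] at h1
      exact Finset.notMem_erase _ _ h1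
    exact Prod.ext (by omega) (by omega)
  · intro τ hτ hτ'
    have hlt := Finset.card_lt_card (Finset.mem_ssubsets.1 hτ)
    have hne : τ.card ≠ n := by
      intro hc
      obtain ⟨v, hv, hvτ⟩ := Finset.exists_of_ssubset (Finset.mem_ssubsets.1 hτ)
      refine hτ' (Finset.mem_image.2 ⟨((v - 1).toNat, (n + 1 - v).toNat), ?_, ?_⟩)
      · simp only [hs, Finset.mem_Icc] at hv
        rw [Finset.HasAntidiagonal.mem_antidiagonal]
        omega
      · have hv' : (((v - 1).toNat : ℤ) + 1) = v := by
          simp only [hs, Finset.mem_Icc] at hv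
          omega
        simp only [hv']
        refine (Finset.eq_of_subset_of_card_le
          (Finset.subset_erase.2 ⟨(Finset.mem_ssubsets.1 hτ).1, hvτ⟩) ?_).symm
        rw [Finset.card_erase_of_mem hv]
        omega
    have : n - τ.card ≠ 0 := by omega
    simp [this]

end LineGraph

/-! ### Faces of the cube complex as words in three letters. -/

section Words

/-- The sum of `f S S'` over the words of length `n` in three letters, where `S` and `S'` are the
sets of positions of the first two letters, and each occurrence of the third has weight `X`. -/
noncomputable def wordSum : ℕ → (Finset ℤ → Finset ℤ → ℚ[X]) → ℚ[X]
  | 0, f => f ∅ ∅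
  | n + 1, f => wordSum n fun S S' =>
      f (insert (n + 1 : ℤ) S) S' + f S (insert (n + 1 : ℤ) S') + Polynomial.X * f S S'

theorem wordSum_congr {n : ℕ} {f g : Finset ℤ → Finset ℤ → ℚ[X]}
    (h : ∀ S ⊆ Finset.Icc (1 : ℤ) n, ∀ S' ⊆ Finset.Icc (1 : ℤ) n, f S S' = g S S') :
    wordSum n f = wordSum n g := by
  induction n generalizing f g with
  | zero => exact h ∅ (Finset.empty_subset _) ∅ (Finset.empty_subset _)
  | succ n ih =>
    refine ih fun S hS S' hS' => ?_
    have h1 : Finset.Icc (1 : ℤ) n ⊆ Finset.Icc (1 : ℤ) (n + 1 : ℕ) :=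
      Finset.Icc_subset_Icc_right (by push_cast; omega)
    have h2 : (n + 1 : ℤ) ∈ Finset.Icc (1 : ℤ) (n + 1 : ℕ) := by
      rw [Finset.mem_Icc]
      push_cast
      omega
    rw [h _ (Finset.insert_subset h2 (hS.trans h1)) _ (hS'.trans h1),
      h _ (hS.trans h1) _ (Finset.insert_subset h2 (hS'.trans h1)),
      h _ (hS.trans h1) _ (hS'.trans h1)]

theorem wordSum_add (n : ℕ) (f g : Finset ℤ → Finset ℤ → ℚ[X]) :
    wordSum n (fun S S' => f S S' + g S S') = wordSum n f + wordSum n g := by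
  induction n generalizing f g with
  | zero => rfl
  | succ n ih =>
    simp only [wordSum, ← ih]
    congr 1
    funext S S'
    ring

theorem wordSum_mul_left (n : ℕ) (c : ℚ[X]) (f : Finset ℤ → Finset ℤ → ℚ[X]) :
    wordSum n (fun S S' => c * f S S') = c * wordSum n f := by
  induction n generalizing f with
  | zero => rfl
  | succ n ih =>
    simp only [wordSum, ← ih]
    congr 1
    funext S S'
    ring

open Classical in
/-- The faces of the dual complex of the cube, as a finite set. -/
noncomputable def cubeFinset (n : ℕ) : Finset (Finset ℤ) :=
  (Finset.Icc (-n : ℤ) n).powerset.filter (· ∈ cubeFaces n)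

theorem mem_cubeFinset {n : ℕ} {σ : Finset ℤ} : σ ∈ cubeFinset n ↔ σ ∈ cubeFaces n := by
  simp only [cubeFinset, Finset.mem_filter, Finset.mem_powerset, and_iff_right_iff_imp]
  exact fun h v hv => Finset.mem_Icc.2 (abs_le.1 (h v hv).2.1)

theorem card_le_of_mem_cubeFaces {n : ℕ} {σ : Finset ℤ} (h : σ ∈ cubeFaces n) : σ.card ≤ n := by
  have : σ.card ≤ (Finset.Icc 1 n).card := by
    refine Finset.card_le_card_of_injOn Int.natAbs (fun v hv => ?_) fun u hu v hv e => ?_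
    · obtain ⟨h1, h2, -⟩ := h v hv
      rw [abs_le] at h2
      rw [Finset.coe_Icc, Set.mem_Icc]
      omega
    · rcases Int.natAbs_eq_natAbs_iff.1 e with e | e
      · exact e
      · exact absurd (e ▸ hu) (h v hv).2.2
  simpa using this

theorem sum_cubeFinset_succ (n : ℕ) (f : Finset ℤ → ℚ[X]) :
    ∑ σ ∈ cubeFinset (n + 1), f σ = ∑ σ ∈ cubeFinset n,
      (f (insert (n + 1 : ℤ) σ) + f (insert (-(n + 1) : ℤ) σ) + f σ) := by
  have hbd : ∀ σ ∈ cubeFinset n, ∀ v ∈ σ, v ≠ 0 ∧ -(n : ℤ) ≤ v ∧ v ≤ n ∧ -v ∉ σ :=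
    fun σ hσ v hv => by
      obtain ⟨h1, h2, h3⟩ := mem_cubeFinset.1 hσ v hv
      exact ⟨h1, (abs_le.1 h2).1, (abs_le.1 h2).2, h3⟩
  have hne : ∀ σ ∈ cubeFinset n, (n + 1 : ℤ) ∉ σ ∧ (-(n + 1) : ℤ) ∉ σ := fun σ hσ =>
    ⟨fun h => by have := hbd σ hσ _ h; omega, fun h => by have := hbd σ hσ _ h; omega⟩
  have heq : cubeFinset (n + 1) = ((cubeFinset n).image (insert (n + 1 : ℤ)) ∪
      (cubeFinset n).image (insert (-(n + 1) : ℤ))) ∪ cubeFinset n := by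
    ext σ
    simp only [Finset.mem_union, Finset.mem_image]
    constructor
    · intro hσ
      rw [mem_cubeFinset] at hσ
      have herase : ∀ w : ℤ, (w = n + 1 ∨ w = -(n + 1)) → w ∈ σ → σ.erase w ∈ cubeFinset n := by
        intro w hw hwσ
        rw [mem_cubeFinset]
        intro v hv
        obtain ⟨hvw, hv⟩ := Finset.mem_erase.1 hv
        obtain ⟨h1, h2, h3⟩ := hσ v hv
        have h4 : v ≠ -w := fun e => (hσ w hwσ).2.2 (e ▸ hv)
        refine ⟨h1, ?_, fun h => h3 (Finset.mem_of_mem_erase h)⟩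
        rw [abs_le] at h2 ⊢
        push_cast at h2
        omega
      by_cases hp : (n + 1 : ℤ) ∈ σ
      · exact Or.inl (Or.inl ⟨_, herase _ (Or.inl rfl) hp, Finset.insert_erase hp⟩)
      by_cases hm : (-(n + 1) : ℤ) ∈ σ
      · exact Or.inl (Or.inr ⟨_, herase _ (Or.inr rfl) hm, Finset.insert_erase hm⟩)
      refine Or.inr (mem_cubeFinset.2 fun v hv => ?_)
      obtain ⟨h1, h2, h3⟩ := hσ v hv
      have h4 : v ≠ n + 1 := fun e => hp (e ▸ hv)
      have h5 : v ≠ -(n + 1) := fun e => hm (e ▸ hv)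
      refine ⟨h1, ?_, h3⟩
      rw [abs_le] at h2 ⊢
      push_cast at h2
      omega
    · have hinsert : ∀ w : ℤ, (w = n + 1 ∨ w = -(n + 1)) → ∀ τ ∈ cubeFinset n,
          insert w τ ∈ cubeFinset (n + 1) := by
        intro w hw τ hτ
        rw [mem_cubeFinset]
        intro v hv
        rw [abs_le, Finset.mem_insert]
        push_cast
        rcases Finset.mem_insert.1 hv with rfl | hv
        · refine ⟨by omega, by omega, ?_⟩
          rintro (h | h)
          · omega
          · have := hbd τ hτ _ h
            omega
        · obtain ⟨h1, h2, h3, h4⟩ := hbd τ hτ v hv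
          refine ⟨h1, by omega, ?_⟩
          rintro (h | h)
          · omega
          · exact h4 h
      rintro ((⟨τ, hτ, rfl⟩ | ⟨τ, hτ, rfl⟩) | hσ)
      · exact hinsert _ (Or.inl rfl) τ hτ
      · exact hinsert _ (Or.inr rfl) τ hτ
      · rw [mem_cubeFinset]
        intro v hv
        obtain ⟨h1, h2, h3, h4⟩ := hbd σ hσ v hv
        refine ⟨h1, ?_, h4⟩
        rw [abs_le]
        push_cast
        omega
  have hinj : ∀ w : ℤ, (∀ σ ∈ cubeFinset n, w ∉ σ) →
      Set.InjOn (insert w) (cubeFinset n : Set (Finset ℤ)) := by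
    intro w hw σ hσ τ hτ e
    rw [← Finset.erase_insert (hw σ hσ), ← Finset.erase_insert (hw τ hτ)]
    exact congrArg (fun x : Finset ℤ => x.erase w) e
  rw [heq, Finset.sum_union, Finset.sum_union,
    Finset.sum_image (hinj _ fun σ hσ => (hne σ hσ).1),
    Finset.sum_image (hinj _ fun σ hσ => (hne σ hσ).2), Finset.sum_add_distrib,
    Finset.sum_add_distrib]
  · refine Finset.disjoint_left.2 fun σ h1 h2 => ?_
    obtain ⟨τ, hτ, rfl⟩ := Finset.mem_image.1 h1
    obtain ⟨ρ, hρ, e⟩ := Finset.mem_image.1 h2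
    have : (n + 1 : ℤ) ∈ insert (-(n + 1) : ℤ) ρ := e ▸ Finset.mem_insert_self _ _
    rcases Finset.mem_insert.1 this with h | h
    · omega
    · exact (hne ρ hρ).1 h
  · refine Finset.disjoint_left.2 fun σ h1 h2 => ?_
    rcases Finset.mem_union.1 h1 with h1 | h1
    · obtain ⟨τ, hτ, rfl⟩ := Finset.mem_image.1 h1
      exact (hne _ h2).1 (Finset.mem_insert_self _ _)
    · obtain ⟨τ, hτ, rfl⟩ := Finset.mem_image.1 h1
      exact (hne _ h2).2 (Finset.mem_insert_self _ _)

/-- The i-th letter says whether the face contains i, -i or neither; the third case occurs n - |σ|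
times, which accounts for the power of x. -/
theorem sum_cubeFinset (n : ℕ) (f : Finset ℤ → ℚ[X]) :
    ∑ σ ∈ cubeFinset n, Polynomial.X ^ (n - σ.card) * f σ =
      wordSum n fun S S' => f (S ∪ S'.image Neg.neg) := by
  induction n generalizing f with
  | zero =>
    have : cubeFinset 0 = {∅} := by
      ext σ
      rw [mem_cubeFinset, Finset.mem_singleton]
      constructor
      · exact fun h => Finset.card_eq_zero.1 (Nat.le_zero.1 (card_le_of_mem_cubeFaces h))
      · rintro rfl
        simp [cubeFaces]
    simp [this, wordSum]
  | succ n ih =>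
    have h1 := ih fun σ => f (insert (n + 1 : ℤ) σ) + f (insert (-(n + 1) : ℤ) σ) +
      Polynomial.X * f σ
    simp only [wordSum, Finset.insert_union, Finset.image_insert, Finset.union_insert]
    rw [← h1, sum_cubeFinset_succ]
    refine Finset.sum_congr rfl fun σ hσ => ?_
    have hσ' := mem_cubeFinset.1 hσ
    have hc := card_le_of_mem_cubeFaces hσ'
    have h2 : (n + 1 : ℤ) ∉ σ := fun h => by
      have := (abs_le.1 (hσ' _ h).2.1).2
      omega
    have h3 : (-(n + 1) : ℤ) ∉ σ := fun h => by
      have := (abs_le.1 (hσ' _ h).2.1).1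
      omega
    rw [Finset.card_insert_of_notMem h2, Finset.card_insert_of_notMem h3,
      Nat.add_sub_add_right, Nat.succ_sub hc, pow_succ]
    ring

end Words

/-! ### The three families laid out on the line. -/

section Families

/-- The positions of `±[n]` on a line: `1, …, n` stay in place, and `-i` is put at `d + i`. -/
def linePosition (d : ℕ) (v : ℤ) : ℤ := if 0 < v then v else d - v

theorem image_linePosition {n d : ℕ} {S S' : Finset ℤ} (hS : S ⊆ Finset.Icc (1 : ℤ) n)
    (hS' : S' ⊆ Finset.Icc (1 : ℤ) n) :
    (S ∪ S'.image Neg.neg).image (linePosition d) = S ∪ S'.image (· + (d : ℤ)) := by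
  rw [Finset.image_union, Finset.image_image]
  congr 1
  · refine (Finset.image_congr fun v hv => ?_).trans Finset.image_id
    have := Finset.mem_Icc.1 (hS hv)
    exact if_pos (by omega)
  · refine Finset.image_congr fun v hv => ?_
    have := Finset.mem_Icc.1 (hS' hv)
    simp only [linePosition, Function.comp_apply]
    rw [if_neg (by omega)]
    omega

theorem linePosition_injOn {n d : ℕ} (hd : n ≤ d) {σ : Finset ℤ} (hσ : σ ∈ cubeFaces n) :
    Set.InjOn (linePosition d) σ := by
  intro u hu v hv e
  have h1 := hσ u hu
  have h2 := hσ v hv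
  rw [abs_le] at h1 h2
  simp only [linePosition] at e
  split_ifs at e <;> omega

theorem pair_mem_cubeFaces {n : ℕ} {σ : Finset ℤ} (hσ : σ ∈ cubeFaces n) {u v : ℤ} (hu : u ∈ σ)
    (hv : v ∈ σ) : ({u, v} : Finset ℤ) ∈ cubeFaces n := by
  have hsub : ({u, v} : Finset ℤ) ⊆ σ := by simp [Finset.insert_subset_iff, hu, hv]
  exact fun w hw => ⟨(hσ w (hsub hw)).1, (hσ w (hsub hw)).2.1,
    fun h => (hσ w (hsub hw)).2.2 (hsub h)⟩

theorem hypercubeGraph_adj {n : ℕ} {r : ℤ → ℤ → Prop} {σ : Finset ℤ} (hσ : σ ∈ cubeFaces n)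
    {u v : ℤ} (hu : u ∈ σ) (hv : v ∈ σ) :
    (hypercubeGraph n r).graph.Adj u v ↔ u ≠ v ∧ (r u v ∨ r v u) :=
  ⟨fun h => ⟨h.1, h.2.1⟩, fun h => ⟨h.1, h.2, pair_mem_cubeFaces hσ hu hv⟩⟩

/-- With offset `n` the vertex -1 comes directly after `n`. For n = 1 these two positions are
neighbours without an edge, but no face contains both vertices. -/
theorem twistedPath_adj {n : ℕ} {σ : Finset ℤ} (hσ : σ ∈ cubeFaces n) {u v : ℤ} (hu : u ∈ σ)
    (hv : v ∈ σ) : (twistedPath n).graph.Adj u v ↔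
      lineGraph.Adj (linePosition n u) (linePosition n v) := by
  rw [twistedPath, hypercubeGraph_adj hσ hu hv, lineGraph_adj]
  have h1 := hσ u hu
  have h2 := hσ v hv
  rw [abs_le] at h1 h2
  simp only [linePosition]
  split_ifs <;> omega

/-- The offset `n + 1` leaves position n + 1 empty, which keeps the two paths apart. -/
theorem doublePath_adj {n : ℕ} {σ : Finset ℤ} (hσ : σ ∈ cubeFaces n) {u v : ℤ} (hu : u ∈ σ)
    (hv : v ∈ σ) : (doublePath n).graph.Adj u v ↔
      lineGraph.Adj (linePosition (n + 1) u) (linePosition (n + 1) v) := by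
  rw [doublePath, hypercubeGraph_adj hσ hu hv, lineGraph_adj]
  have h1 := hσ u hu
  have h2 := hσ v hv
  rw [abs_le] at h1 h2
  simp only [linePosition]
  split_ifs <;> push_cast <;> omega

theorem DeltaGraph.delete_adj {V : Type*} [DecidableEq V] {G : DeltaGraph V} {S σ : Finset V}
    (hσ : σ ∈ (G.delete S).faces) {u v : V} (hu : u ∈ σ) (hv : v ∈ σ) :
    (G.delete S).graph.Adj u v ↔ G.graph.Adj u v := by
  refine ⟨fun h => h.2.1.elim id fun h => h.symm, fun h => ⟨h.ne, Or.inl h, ?_⟩⟩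
  exact (G.delete S).down_closed σ hσ _ (by simp [Finset.insert_subset_iff, hu, hv])

theorem coeff_twistedPath (n : ℕ) : PowerSeries.coeff n (bivariateF twistedPath) =
    wordSum n fun S S' => linePoly (S ∪ S'.image (· + (n : ℤ))) := by
  rw [coeff_bivariateF_eq_sum (G := twistedPath) (n := n) (S := cubeFinset n)
    (fun σ => mem_cubeFinset) fun σ hσ => card_le_of_mem_cubeFaces (mem_cubeFinset.1 hσ)]
  have h1 : ∀ σ ∈ cubeFinset n, coverPoly (twistedPath n).graph σ =
      linePoly (σ.image (linePosition n)) := fun σ hσ => by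
    rw [mem_cubeFinset] at hσ
    exact (coverPoly_image (linePosition_injOn le_rfl hσ)
      fun u hu v hv => twistedPath_adj hσ hu hv).symm
  rw [Finset.sum_congr rfl fun σ hσ => by rw [h1 σ hσ],
    sum_cubeFinset n fun σ => linePoly (σ.image (linePosition n))]
  exact wordSum_congr fun S hS S' hS' => by rw [image_linePosition hS hS']

theorem coeff_cisDoublePath (n : ℕ) : PowerSeries.coeff n (bivariateF cisDoublePath) =
    wordSum n fun S S' => if (1 : ℤ) ∈ S' ∨ (n : ℤ) ∈ S' then 0 else linePoly S * linePoly S' := by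
  classical
  have hmem : ∀ σ, σ ∈ (cisDoublePath n).faces ↔
      σ ∈ cubeFaces n ∧ ¬ ((-1 : ℤ) ∈ σ ∨ (-n : ℤ) ∈ σ) := fun σ => by
    refine and_congr_right fun _ => ?_
    rw [Finset.disjoint_insert_right, Finset.disjoint_singleton_right, not_or]
  rw [coeff_bivariateF_eq_sum (G := cisDoublePath) (n := n)
    (S := (cubeFinset n).filter fun σ => ¬ ((-1 : ℤ) ∈ σ ∨ (-n : ℤ) ∈ σ))
    (fun σ => by rw [Finset.mem_filter, hmem, mem_cubeFinset]) fun σ hσ =>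
      card_le_of_mem_cubeFaces (mem_cubeFinset.1 (Finset.mem_filter.1 hσ).1), Finset.sum_filter]
  have h1 : ∀ σ ∈ cubeFinset n, (if ¬ ((-1 : ℤ) ∈ σ ∨ (-n : ℤ) ∈ σ) then
      Polynomial.X ^ (n - σ.card) * coverPoly (cisDoublePath n).graph σ else 0) =
      Polynomial.X ^ (n - σ.card) * if (-1 : ℤ) ∈ σ ∨ (-n : ℤ) ∈ σ then 0 else
        linePoly (σ.image (linePosition (n + 1))) := fun σ hσ => by
    rw [mem_cubeFinset] at hσ
    by_cases h : (-1 : ℤ) ∈ σ ∨ (-n : ℤ) ∈ σ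
    · rw [if_neg (not_not.2 h), if_pos h, mul_zero]
    · rw [if_pos h, if_neg h]
      congr 1
      have hf : σ ∈ ((doublePath n).delete {-1, -(n : ℤ)}).faces := (hmem σ).2 ⟨hσ, h⟩
      refine (coverPoly_image (linePosition_injOn (Nat.le_succ n) hσ) fun u hu v hv => ?_).symm
      rw [cisDoublePath, DeltaGraph.delete_adj hf hu hv]
      exact doublePath_adj hσ hu hv
  rw [Finset.sum_congr rfl h1, sum_cubeFinset n fun σ => if (-1 : ℤ) ∈ σ ∨ (-n : ℤ) ∈ σ then 0
    else linePoly (σ.image (linePosition (n + 1)))]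
  refine wordSum_congr fun S hS S' hS' => ?_
  rw [image_linePosition hS hS', linePoly_union, linePoly_add]
  · have h2 : ∀ w : ℤ, 0 ≤ w → (-w ∈ S ∪ S'.image Neg.neg ↔ w ∈ S') := fun w hw => by
      rw [Finset.mem_union, Finset.mem_image]
      constructor
      · rintro (h | ⟨v, hv, e⟩)
        · have := Finset.mem_Icc.1 (hS h)
          omega
        · exact neg_injective e ▸ hv
      · exact fun h => Or.inr ⟨w, h, rfl⟩
    simp only [h2 1 (by omega), h2 n (by omega)]
  · intro u hu v hv
    obtain ⟨w, hw, rfl⟩ := Finset.mem_image.1 hv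
    have h3 := Finset.mem_Icc.1 (hS hu)
    have h4 := Finset.mem_Icc.1 (hS' hw)
    push_cast
    omega

/-- The index shifts by one because tubings covering the whole path on n + 1 vertices differ from
those of the simplex path only by the tube of all vertices. -/
theorem coeff_simplexPath (n : ℕ) :
    PowerSeries.coeff n (bivariateF simplexPath) = pathPoly (n + 1) := by
  have hmem : ∀ σ, σ ∈ (Finset.Icc (1 : ℤ) (n + 1)).ssubsets ↔ σ ∈ (simplexPath n).faces :=
    fun σ => Finset.mem_ssubsets
  rw [coeff_bivariateF_eq_sum hmem, pathPoly_succ]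
  · refine Finset.sum_congr rfl fun σ hσ => ?_
    congr 1
    refine coverPoly_congr fun u hu v hv => ⟨fun h => ⟨h.ne, h, ?_⟩, fun h => h.2.1⟩
    exact (simplexPath n).down_closed σ ((hmem σ).1 hσ) _
      (by simp [Finset.insert_subset_iff, hu, hv])
  · intro σ hσ
    have := Finset.card_lt_card (Finset.mem_ssubsets.1 hσ)
    simp only [Int.card_Icc] at this
    omega

end Families

/-! ### Transfer recursion and generating functions. -/

section WordSeries

/-- Solution of the linear recursion that results from removing the last letter of a word. -/
theorem transfer_recursion {R : Type*} [CommRing R] {b β : ℕ → R} {x : R} {Y Z : ℕ → ℕ → R}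
    (hb : b 0 = 1) (hY : ∀ j, Y 0 j = b j * β 0) (hZ : ∀ j, Z 0 j = β j)
    (hYs : ∀ n j, Y (n + 1) j = Y n (j + 1) + b j * (Z n 1 + x * Y n 0))
    (hZs : ∀ n j, Z (n + 1) j = Z n (j + 1) + b j * (Y n 1 + x * Y n 0))
    {B D P Q : R⟦X⟧} (hB : B = PowerSeries.mk b)
    (hD : D = 1 - (B - 1) - PowerSeries.C x * PowerSeries.X * B)
    (hP : P = PowerSeries.C (β 0) + PowerSeries.X * PowerSeries.mk fun n => Z n 1 + x * Y n 0)
    (hQ : Q = PowerSeries.X * PowerSeries.mk fun n => Y n 1 + x * Y n 0) :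
    P * (D * B) = PowerSeries.mk β ∧ Q = (1 - D) * P := by
  have hPs : ∀ n, PowerSeries.coeff (n + 1) P = Z n 1 + x * Y n 0 := fun n => by
    simp [hP, PowerSeries.coeff_succ_X_mul]
  have hQs : ∀ n, PowerSeries.coeff (n + 1) Q = Y n 1 + x * Y n 0 := fun n => by
    simp [hQ, PowerSeries.coeff_succ_X_mul]
  -- Unrolls the final run of first letters: if it has length i, it merges with the appended j into
  -- the factor b (i + j), and what precedes it is counted by `P`.
  have hYP : ∀ n j, Y n j =
      ∑ p ∈ Finset.HasAntidiagonal.antidiagonal n, b (p.1 + j) * PowerSeries.coeff p.2 P := by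
    intro n
    induction n with
    | zero => intro j; simp [hY, hP]
    | succ n ih =>
      intro j
      rw [hYs, ih, Finset.Nat.sum_antidiagonal_succ, hPs, add_comm, zero_add]
      simp only [add_assoc, add_comm 1 j]
  have hZQ : ∀ n j, Z n j = β (n + j) +
      ∑ p ∈ Finset.HasAntidiagonal.antidiagonal n, b (p.1 + j) * PowerSeries.coeff p.2 Q := by
    intro n
    induction n with
    | zero => intro j; simp [hZ, hQ]
    | succ n ih =>
      intro j
      rw [hZs, ih, Finset.Nat.sum_antidiagonal_succ, hQs, zero_add,
        add_comm (b j * _), ← add_assoc]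
      simp only [add_assoc, add_comm 1 j]
  have hBs : B = 1 + PowerSeries.X * PowerSeries.mk fun n => b (n + 1) := by
    ext n
    cases n with
    | zero => simp [hB, hb]
    | succ n => simp [hB, PowerSeries.coeff_succ_X_mul, PowerSeries.coeff_one]
  have hβs : PowerSeries.mk β =
      PowerSeries.C (β 0) + PowerSeries.X * PowerSeries.mk fun n => β (n + 1) := by
    ext n
    cases n with
    | zero => simp
    | succ n => simp [PowerSeries.coeff_succ_X_mul]
  have hY0 : (PowerSeries.mk fun n => Y n 0) = B * P := by
    ext n
    rw [PowerSeries.coeff_mk, PowerSeries.coeff_mul, hYP, hB]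
    simp
  have hY1 : (PowerSeries.mk fun n => Y n 1) = (PowerSeries.mk fun n => b (n + 1)) * P := by
    ext n
    rw [PowerSeries.coeff_mk, PowerSeries.coeff_mul, hYP]
    simp
  have hZ1 : (PowerSeries.mk fun n => Z n 1) =
      (PowerSeries.mk fun n => β (n + 1)) + (PowerSeries.mk fun n => b (n + 1)) * Q := by
    ext n
    rw [PowerSeries.coeff_mk, map_add, PowerSeries.coeff_mul, hZQ]
    simp
  have hsplit : ∀ W : ℕ → R, (PowerSeries.mk fun n => W n + x * Y n 0) =
      PowerSeries.mk W + PowerSeries.C x * (B * P) := fun W => by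
    rw [← hY0]
    ext n
    simp
  rw [hsplit, hZ1] at hP
  rw [hsplit, hY1] at hQ
  have hP' : P = PowerSeries.mk β + (B - 1) * Q + PowerSeries.C x * PowerSeries.X * B * P := by
    rw [hβs, hBs]
    rw [hBs] at hP
    linear_combination hP
  have hQ' : Q = (1 - D) * P := by
    rw [hD]
    linear_combination hQ - P * hBs
  refine ⟨?_, hQ'⟩
  rw [hQ'] at hP'
  linear_combination hP' + P * hD

/-- A weight of sets of positions that is multiplicative with respect to a final run. -/
def SplitsFinalRun (φ : Finset ℤ → ℚ[X]) : Prop :=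
  ∀ (n j : ℕ), ∀ S ⊆ Finset.Icc (1 : ℤ) n,
    φ (S ∪ Finset.Icc (n + 2 : ℤ) (n + 1 + j)) = φ S * pathPoly j

/-- Words followed by a run of `j` occurrences of the first letter. -/
noncomputable def wordSumFirst (φ : Finset ℤ → ℚ[X]) (n j : ℕ) : ℚ[X] :=
  wordSum n fun S S' => linePoly (S ∪ Finset.Icc (n + 1 : ℤ) (n + j)) * φ S'

/-- Words followed by a run of `j` occurrences of the second letter. -/
noncomputable def wordSumSecond (φ : Finset ℤ → ℚ[X]) (n j : ℕ) : ℚ[X] :=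
  wordSum n fun S S' => linePoly S * φ (S' ∪ Finset.Icc (n + 1 : ℤ) (n + j))

theorem splitsFinalRun_linePoly : SplitsFinalRun linePoly := by
  intro n j S hS
  rw [linePoly_union, linePoly_Icc (j := j) (by omega)]
  intro u hu v hv
  have h1 := Finset.mem_Icc.1 (hS hu)
  have h2 := Finset.mem_Icc.1 hv
  omega

theorem insert_union_Icc (n j : ℕ) (S : Finset ℤ) :
    insert (n + 1 : ℤ) S ∪ Finset.Icc (((n + 1 : ℕ) : ℤ) + 1) ((n + 1 : ℕ) + j) =
      S ∪ Finset.Icc (n + 1 : ℤ) (n + (j + 1 : ℕ)) := by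
  ext v
  simp only [Finset.mem_union, Finset.mem_insert, Finset.mem_Icc]
  push_cast
  by_cases h : v ∈ S
  · simp [h]
  · simp only [h, or_false, false_or]
    omega

theorem union_Icc_one (n : ℕ) (S : Finset ℤ) :
    S ∪ Finset.Icc (n + 1 : ℤ) (n + (1 : ℕ)) = insert (n + 1 : ℤ) S := by
  rw [Nat.cast_one, Finset.Icc_self, Finset.union_comm]
  rfl

theorem union_Icc_zero (n : ℕ) (S : Finset ℤ) :
    S ∪ Finset.Icc (n + 1 : ℤ) (n + (0 : ℕ)) = S := by
  rw [Finset.Icc_eq_empty (by push_cast; omega), Finset.union_empty]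

theorem SplitsFinalRun.apply_succ {φ : Finset ℤ → ℚ[X]} (hφ : SplitsFinalRun φ) {n : ℕ} (j : ℕ)
    {S : Finset ℤ} (hS : S ⊆ Finset.Icc (1 : ℤ) n) :
    φ (S ∪ Finset.Icc (((n + 1 : ℕ) : ℤ) + 1) ((n + 1 : ℕ) + j)) = φ S * pathPoly j := by
  rw [← hφ n j S hS]
  congr 3

/-- A last letter of the first kind lengthens the appended run. Any other last letter leaves a gap
in front of the run, which splits off as `pathPoly j`. -/
theorem wordSumFirst_succ {φ : Finset ℤ → ℚ[X]} (n j : ℕ) :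
    wordSumFirst φ (n + 1) j = wordSumFirst φ n (j + 1) +
      pathPoly j * (wordSumSecond φ n 1 + Polynomial.X * wordSumFirst φ n 0) := by
  simp only [wordSumFirst, wordSumSecond, mul_add, ← wordSum_mul_left, ← wordSum_add, ← add_assoc]
  rw [wordSum]
  refine wordSum_congr fun S hS S' hS' => ?_
  rw [insert_union_Icc, splitsFinalRun_linePoly.apply_succ j hS, union_Icc_one, union_Icc_zero]
  ring

theorem wordSumSecond_succ {φ : Finset ℤ → ℚ[X]} (hφ : SplitsFinalRun φ) (n j : ℕ) :
    wordSumSecond φ (n + 1) j = wordSumSecond φ n (j + 1) +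
      pathPoly j * (wordSumFirst φ n 1 + Polynomial.X * wordSumFirst φ n 0) := by
  simp only [wordSumFirst, wordSumSecond, mul_add, ← wordSum_mul_left, ← wordSum_add, ← add_assoc]
  rw [wordSum]
  refine wordSum_congr fun S hS S' hS' => ?_
  rw [insert_union_Icc, hφ.apply_succ j hS', union_Icc_one, union_Icc_zero]
  ring

/-- The denominator of the generating functions. -/
noncomputable def wordDenominator : ℚ[X]⟦X⟧ :=
  1 - (PowerSeries.mk pathPoly - 1) -
    PowerSeries.C Polynomial.X * PowerSeries.X * PowerSeries.mk pathPoly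

theorem wordSum_transfer {φ : Finset ℤ → ℚ[X]} (hφ : SplitsFinalRun φ) {P Q : ℚ[X]⟦X⟧}
    (hP : P = PowerSeries.C (φ ∅) + PowerSeries.X * PowerSeries.mk fun n =>
      wordSumSecond φ n 1 + Polynomial.X * wordSumFirst φ n 0)
    (hQ : Q = PowerSeries.X * PowerSeries.mk fun n =>
      wordSumFirst φ n 1 + Polynomial.X * wordSumFirst φ n 0) :
    P * (wordDenominator * PowerSeries.mk pathPoly) =
      PowerSeries.mk (fun j => φ (Finset.Icc 1 (j : ℤ))) ∧ Q = (1 - wordDenominator) * P := by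
  refine transfer_recursion (x := Polynomial.X) (Y := wordSumFirst φ) (Z := wordSumSecond φ)
    pathPoly_zero ?_ ?_ wordSumFirst_succ (wordSumSecond_succ hφ) rfl rfl (by simpa using hP) hQ
  · intro j
    simp [wordSumFirst, wordSum, pathPoly]
  · intro j
    simp [wordSumSecond, wordSum, linePoly_empty]

/-- The weight of a set of positions in which a run of length `k` is put in front. -/
noncomputable def linePolyAfter (k : ℕ) (S : Finset ℤ) : ℚ[X] :=
  linePoly (Finset.Icc (1 - k : ℤ) 0 ∪ S)

theorem splitsFinalRun_linePolyAfter (k : ℕ) : SplitsFinalRun (linePolyAfter k) := by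
  intro n j S hS
  rw [linePolyAfter, ← Finset.union_assoc, linePoly_union, linePoly_Icc (j := j) (by omega)]
  · rfl
  · intro u hu v hv
    have h2 := Finset.mem_Icc.1 hv
    rcases Finset.mem_union.1 hu with hu | hu
    · have h1 := Finset.mem_Icc.1 hu
      omega
    · have h1 := Finset.mem_Icc.1 (hS hu)
      omega

theorem linePolyAfter_Icc (k j : ℕ) :
    linePolyAfter k (Finset.Icc 1 (j : ℤ)) = pathPoly (k + j) := by
  have : Finset.Icc (1 - k : ℤ) 0 ∪ Finset.Icc 1 (j : ℤ) = Finset.Icc (1 - k : ℤ) j := by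
    ext v
    simp only [Finset.mem_union, Finset.mem_Icc]
    omega
  rw [linePolyAfter, this, linePoly_Icc]
  push_cast
  ring

/-- Words in which a final run of the first letter, prolonged by `k`, is joined to the initial run
of the second letter. -/
noncomputable def twistedWordSum (n k : ℕ) : ℚ[X] :=
  wordSum n fun S S' =>
    linePoly (S ∪ Finset.Icc (n + 1 : ℤ) (n + k) ∪ S'.image (· + (n + k : ℤ)))

theorem linePoly_union_shift {n : ℕ} (k : ℕ) {S S' : Finset ℤ} (hS : S ⊆ Finset.Icc (1 : ℤ) n)
    (hS' : S' ⊆ Finset.Icc (1 : ℤ) (n + 1)) :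
    linePoly (S ∪ Finset.Icc (((n + 1 : ℕ) : ℤ) + 1) ((n + 1 : ℕ) + k) ∪
      S'.image (· + ((n + 1 : ℕ) + k : ℤ))) = linePoly S * linePolyAfter k S' := by
  have h1 : Finset.Icc (((n + 1 : ℕ) : ℤ) + 1) ((n + 1 : ℕ) + k) =
      (Finset.Icc (1 - k : ℤ) 0).image (· + ((n + 1 : ℕ) + k : ℤ)) := by
    rw [Finset.image_add_right_Icc]
    congr 1 <;> ring
  rw [Finset.union_assoc, h1, ← Finset.image_union, linePoly_union, linePoly_add, linePolyAfter]
  intro u hu v hv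
  obtain ⟨w, hw, rfl⟩ := Finset.mem_image.1 hv
  have h2 := Finset.mem_Icc.1 (hS hu)
  push_cast
  rcases Finset.mem_union.1 hw with hw | hw
  · have h3 := Finset.mem_Icc.1 hw
    omega
  · have h3 := Finset.mem_Icc.1 (hS' hw)
    omega

/-- A last first letter moves into the inserted run. Otherwise position n + 1 is empty, so the first
letters separate off, and the inserted run becomes a prefix of the second letters, giving the weight
`linePolyAfter k`. -/
theorem twistedWordSum_succ (n k : ℕ) : twistedWordSum (n + 1) k = twistedWordSum n (k + 1) +
    (wordSumSecond (linePolyAfter k) n 1 + Polynomial.X * wordSumFirst (linePolyAfter k) n 0) := by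
  simp only [wordSumFirst, wordSumSecond, twistedWordSum, ← wordSum_mul_left, ← wordSum_add]
  rw [wordSum]
  refine wordSum_congr fun S hS S' hS' => ?_
  have hS'' : S' ⊆ Finset.Icc (1 : ℤ) (n + 1) :=
    hS'.trans (Finset.Icc_subset_Icc_right (by omega))
  have hins : insert (n + 1 : ℤ) S' ⊆ Finset.Icc (1 : ℤ) (n + 1) :=
    Finset.insert_subset (Finset.mem_Icc.2 (by omega)) hS''
  rw [linePoly_union_shift k hS hS'', linePoly_union_shift k hS hins, insert_union_Icc,
    union_Icc_one, union_Icc_zero]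
  have : ((n + 1 : ℕ) + k : ℤ) = n + (k + 1 : ℕ) := by
    push_cast
    ring
  rw [this]
  ring

/-- With T_k the series of `twistedWordSum · k`, the recursion reads T_k·D·B = y·T_{k+1}·D·B + Σ
b_{k+j} y^j. Unrolling it collects b_{k+n} once for each of the n + 1 ways of splitting n between
the two runs. -/
theorem twistedWordSum_mul_denominator (n k : ℕ) :
    PowerSeries.coeff n (PowerSeries.mk (twistedWordSum · k) *
      (wordDenominator * PowerSeries.mk pathPoly)) = (n + 1 : ℕ) * pathPoly (k + n) := by
  have hrec : ∀ k, PowerSeries.mk (twistedWordSum · k) *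
      (wordDenominator * PowerSeries.mk pathPoly) =
      PowerSeries.X * (PowerSeries.mk (twistedWordSum · (k + 1)) *
        (wordDenominator * PowerSeries.mk pathPoly)) +
        PowerSeries.mk fun n => pathPoly (k + n) := by
    intro k
    have h1 := (wordSum_transfer (splitsFinalRun_linePolyAfter k) rfl rfl).1
    have h2 : PowerSeries.mk (twistedWordSum · k) =
        PowerSeries.X * PowerSeries.mk (twistedWordSum · (k + 1)) +
          (PowerSeries.C (linePolyAfter k ∅) + PowerSeries.X * PowerSeries.mk fun n =>
            wordSumSecond (linePolyAfter k) n 1 +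
              Polynomial.X * wordSumFirst (linePolyAfter k) n 0) := by
      ext1 n
      cases n with
      | zero => simp [twistedWordSum, wordSum, linePolyAfter, linePoly_Icc (a := 1) (j := k)
          (c := k) (by omega), linePoly_Icc (a := 1 - k) (j := k) (c := 0) (by omega)]
      | succ n => simp [PowerSeries.coeff_succ_X_mul, twistedWordSum_succ]
    simp only [linePolyAfter_Icc] at h1
    rw [← h1, h2]
    ring
  induction n generalizing k with
  | zero =>
    rw [hrec, map_add, PowerSeries.coeff_zero_X_mul, PowerSeries.coeff_mk]
    simp
  | succ n ih =>
    rw [hrec, map_add, PowerSeries.coeff_succ_X_mul, PowerSeries.coeff_mk, ih]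
    have : k + 1 + n = k + (n + 1) := by omega
    rw [this]
    push_cast
    ring

/-- The weight of the sets of positions that do not contain the first position. -/
noncomputable def linePolyAvoidOne (S : Finset ℤ) : ℚ[X] :=
  if (1 : ℤ) ∈ S then 0 else linePoly S

theorem splitsFinalRun_linePolyAvoidOne : SplitsFinalRun linePolyAvoidOne := by
  intro n j S hS
  have h : (1 : ℤ) ∈ S ∪ Finset.Icc (n + 2 : ℤ) (n + 1 + j) ↔ (1 : ℤ) ∈ S := by
    rw [Finset.mem_union, Finset.mem_Icc]
    exact ⟨fun h => h.resolve_right (by omega), Or.inl⟩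
  simp only [linePolyAvoidOne, h, splitsFinalRun_linePoly n j S hS, ite_mul, zero_mul]

/-- Deleting -n forbids the second letter in last place, which selects the series `Q` of the
transfer recursion. Deleting -1 is absorbed into the weight `linePolyAvoidOne`. -/
theorem bivariateF_cisDoublePath : bivariateF cisDoublePath =
    1 + PowerSeries.X * PowerSeries.mk fun n => wordSumFirst linePolyAvoidOne n 1 +
      Polynomial.X * wordSumFirst linePolyAvoidOne n 0 := by
  ext1 n
  rw [coeff_cisDoublePath]
  cases n with
  | zero => simp [wordSum, linePoly_empty]
  | succ n =>
    simp only [map_add, PowerSeries.coeff_succ_X_mul, PowerSeries.coeff_mk, PowerSeries.coeff_one,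
      Nat.add_eq_zero_iff, one_ne_zero, and_false, if_false, zero_add, wordSumFirst,
      ← wordSum_mul_left, ← wordSum_add]
    rw [wordSum]
    refine wordSum_congr fun S hS S' hS' => ?_
    have h1 : (n + 1 : ℤ) ∉ S' := fun h => by
      have := Finset.mem_Icc.1 (hS' h)
      omega
    rw [union_Icc_one, union_Icc_zero]
    simp [linePolyAvoidOne, h1]

theorem bivariateF_cisDoublePath_mul :
    (bivariateF cisDoublePath - 1) * (wordDenominator * PowerSeries.mk pathPoly) =
      1 - wordDenominator := by
  obtain ⟨h1, h2⟩ := wordSum_transfer splitsFinalRun_linePolyAvoidOne rfl rfl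
  -- Every nonempty initial run contains position 1 and has weight 0.
  have h3 : (PowerSeries.mk fun j : ℕ => linePolyAvoidOne (Finset.Icc 1 (j : ℤ))) = 1 := by
    ext1 j
    cases j with
    | zero => simp [linePolyAvoidOne, linePoly_empty]
    | succ j => simp [linePolyAvoidOne, PowerSeries.coeff_one]
  rw [bivariateF_cisDoublePath, add_sub_cancel_left, h2, mul_assoc, h1, h3, mul_one]

theorem mk_pathPoly : PowerSeries.mk pathPoly = 1 + PowerSeries.X * bivariateF simplexPath := by
  ext1 n
  cases n with
  | zero => simp [pathPoly_zero]
  | succ n => simp [PowerSeries.coeff_succ_X_mul, PowerSeries.coeff_one, coeff_simplexPath]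

theorem bivariateF_twistedPath_mul :
    bivariateF twistedPath * (wordDenominator * PowerSeries.mk pathPoly) =
      1 + PowerSeries.X * (2 * bivariateF simplexPath +
        PowerSeries.X * PowerSeries.derivative ℚ[X] (bivariateF simplexPath)) := by
  have h1 : bivariateF twistedPath = PowerSeries.mk (twistedWordSum · 0) := by
    ext1 n
    rw [coeff_twistedPath, PowerSeries.coeff_mk]
    refine wordSum_congr fun S _ S' _ => ?_
    rw [union_Icc_zero]
    simp
  ext1 n
  rw [h1, twistedWordSum_mul_denominator, zero_add, two_mul]
  cases n with
  | zero => simp [pathPoly_zero]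
  | succ n =>
    rw [map_add, PowerSeries.coeff_succ_X_mul, map_add, map_add]
    cases n with
    | zero => simp [coeff_simplexPath, PowerSeries.coeff_one]; ring
    | succ n =>
      rw [PowerSeries.coeff_succ_X_mul, PowerSeries.coeff_derivative]
      simp [coeff_simplexPath, PowerSeries.coeff_one]
      ring

theorem isUnit_wordDenominator : IsUnit wordDenominator := by
  rw [PowerSeries.isUnit_iff_constantCoeff]
  simp [wordDenominator, mk_pathPoly]

theorem isUnit_mk_pathPoly : IsUnit (PowerSeries.mk pathPoly) := by
  rw [PowerSeries.isUnit_iff_constantCoeff]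
  simp [mk_pathPoly]

/-- The quadratic equation of the Catalan generating function. -/
theorem map_mk_pathPoly : PowerSeries.map (Polynomial.evalRingHom 0) (PowerSeries.mk pathPoly) =
    1 + PowerSeries.X *
      PowerSeries.map (Polynomial.evalRingHom (0 : ℚ)) (PowerSeries.mk pathPoly) ^ 2 := by
  ext1 n
  cases n with
  | zero => simp [pathPoly_zero]
  | succ n =>
    rw [map_add, PowerSeries.coeff_succ_X_mul, pow_two, PowerSeries.coeff_mul]
    simp [eval_pathPoly_succ, PowerSeries.coeff_one]

theorem map_derivative {R S : Type*} [CommRing R] [CommRing S] (φ : R →+* S) (f : R⟦X⟧) :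
    PowerSeries.map φ (PowerSeries.derivative R f) =
      PowerSeries.derivative S (PowerSeries.map φ f) := by
  ext n
  simp [PowerSeries.coeff_derivative]

end WordSeries

/-! ### Assembly of the face counts, the bivariate formula and the vertex series. -/

theorem mainTheorem5 (fTP fA fC x y : ℚ[X]⟦X⟧)
    (hTP : fTP = bivariateF twistedPath) (hA : fA = bivariateF simplexPath)
    (hC : fC = bivariateF cisDoublePath)
    (hx : x = PowerSeries.C Polynomial.X) (hy : y = PowerSeries.X) :
    -- the coefficient of `y ^ n` is the `f`-polynomial of the `n`-dimensional associahedron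
    ((∀ (n : ℕ) (P : Set (EuclideanSpace ℝ (Fin n))),
        IsGraphAssociahedron (twistedPath n) P → PowerSeries.coeff n fTP = facePolynomial P) ∧
      (∀ (n : ℕ) (P : Set (EuclideanSpace ℝ (Fin n))),
        IsGraphAssociahedron (simplexPath n) P → PowerSeries.coeff n fA = facePolynomial P) ∧
      (∀ (n : ℕ) (P : Set (EuclideanSpace ℝ (Fin n))),
        IsGraphAssociahedron (cisDoublePath n) P → PowerSeries.coeff n fC = facePolynomial P)) ∧
    -- the bivariate formula
    (IsUnit ((1 - x * y) * (1 + y * fA) - 2 * y * fA) ∧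
      fTP = (1 + x * y * Ring.inverse ((1 - x * y) * (1 + y * fA) - 2 * y * fA)
          + y * fA * (fC - 1))
        * (1 + y * (2 * fA + y * PowerSeries.derivative ℚ[X] fA))) ∧
    -- the generating function of the numbers of vertices
    (∃ s : ℚ⟦X⟧, s ^ 2 = 1 - 4 * PowerSeries.X ∧ PowerSeries.constantCoeff s = 1 ∧
      PowerSeries.map (Polynomial.evalRingHom 0) fTP =
        (1 - 2 * PowerSeries.X + s) * (2 * (1 - 4 * PowerSeries.X))⁻¹) := by
  have hB : PowerSeries.mk pathPoly = 1 + y * fA := by rw [hy, hA, mk_pathPoly]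
  have hD : (1 - x * y) * (1 + y * fA) - 2 * y * fA = wordDenominator := by
    rw [wordDenominator, hB, hx, hy]
    ring
  have hDB : wordDenominator = 1 - y * fA - x * y * (1 + y * fA) := by
    rw [← hD]
    ring
  have hTP' := bivariateF_twistedPath_mul
  have hC' := bivariateF_cisDoublePath_mul
  rw [← hTP, ← hA, ← hy] at hTP'
  rw [← hC] at hC'
  refine ⟨⟨fun n P hP => hTP ▸ hP.coeff_bivariateF, fun n P hP => hA ▸ hP.coeff_bivariateF,
    fun n P hP => hC ▸ hP.coeff_bivariateF⟩, ⟨hD ▸ isUnit_wordDenominator, ?_⟩, ?_⟩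
  · rw [hD]
    have hinv := Ring.mul_inverse_cancel _ isUnit_wordDenominator
    refine (isUnit_wordDenominator.mul isUnit_mk_pathPoly).mul_right_cancel ?_
    rw [hTP']
    set J := 1 + y * (2 * fA + y * PowerSeries.derivative ℚ[X] fA)
    set I := Ring.inverse wordDenominator
    rw [hB] at hC' ⊢
    -- With B = 1 + yA the product is DB + xyB + (B - 1)(1 - D) = D + (B - 1) + xyB = 1.
    have key : (1 + x * y * I + y * fA * (fC - 1)) * (wordDenominator * (1 + y * fA)) = 1 := by
      linear_combination x * y * (1 + y * fA) * hinv + y * fA * hC' + hDB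
    linear_combination -J * key
  · set ψ := PowerSeries.map (Polynomial.evalRingHom (0 : ℚ)) with hψ
    set β := ψ (PowerSeries.mk pathPoly) with hβ
    have h2 : PowerSeries.constantCoeff (2 : ℚ⟦X⟧) = 2 := map_ofNat _ 2
    have hψ2 : ψ 2 = 2 := map_ofNat _ 2
    have hquad : β = 1 + PowerSeries.X * β ^ 2 := map_mk_pathPoly
    have hβ0 : PowerSeries.constantCoeff β = 1 := by
      rw [hquad]
      simp
    have hβne : PowerSeries.constantCoeff β ≠ 0 := by rw [hβ0]; exact one_ne_zero
    have hβinv : β * β⁻¹ = 1 := PowerSeries.mul_inv_cancel β hβne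
    have hβ1 : β = 1 + PowerSeries.X * ψ fA := by
      rw [hβ, hB, hy]
      simp [hψ]
    have hden : ψ wordDenominator = 2 - β := by
      rw [hβ, wordDenominator, hψ]
      simp
      ring
    have hder : PowerSeries.derivative ℚ β =
        ψ fA + PowerSeries.X * PowerSeries.derivative ℚ (ψ fA) := by
      rw [hβ1]
      simp
      ring
    have hder' : PowerSeries.derivative ℚ β =
        β ^ 2 + PowerSeries.X * (2 * β * PowerSeries.derivative ℚ β) := by
      conv_lhs => rw [hquad]
      simp
      ring
    have hF := congrArg ψ hTP'
    have hF1 : ψ fTP * ((2 - β) * β) =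
        β + PowerSeries.X * PowerSeries.derivative ℚ β := by
      rw [← hden, hβ, ← map_mul, ← map_mul, hF, hy, hder, ← hβ, hβ1, ← map_derivative]
      simp only [map_add, map_mul, map_one, hψ2]
      rw [hψ, PowerSeries.map_X]
      ring
    -- The quadratic equation gives (1 - 2yβ)β = 2 - β, and its derivative gives (1 - 2yβ)β' = β².
    -- Multiplying `hF1` by 1 - 2yβ therefore eliminates β'.
    have hF2 : ψ fTP * (2 - β) ^ 2 = 1 := by
      linear_combination (1 - 2 * PowerSeries.X * β) * hF1 - 2 * ψ fTP * (2 - β) * hquad +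
        PowerSeries.X * hder' + hquad
    have hsq : (2 - β) ^ 2 = (1 - 4 * PowerSeries.X) * β ^ 2 := by
      linear_combination (-4) * hquad
    have hs : (2 - β) * β⁻¹ * β = 2 - β := by rw [mul_assoc, mul_comm β⁻¹, hβinv, mul_one]
    refine ⟨(2 - β) * β⁻¹, ?_, ?_, ?_⟩
    · linear_combination β⁻¹ ^ 2 * hsq + (1 - 4 * PowerSeries.X) * (β * β⁻¹ + 1) * hβinv
    · simp [hβ0, h2]
      norm_num
    · rw [PowerSeries.eq_mul_inv_iff_mul_eq]
      · have hβunit : IsUnit (β ^ 2) := (IsUnit.of_mul_eq_one _ hβinv).pow 2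
        refine hβunit.mul_right_cancel ?_
        -- The two preceding identities give (1 - 4y)·f^TP(0, y) = β⁻², and with s = (2 - β)/β the
        -- quadratic equation gives (1 - 2y + s)β² = 2.
        linear_combination 2 * hF2 - 2 * ψ fTP * hsq - 2 * hquad - β * hs
      · simp [h2]
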